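/- Let $\mathbb T=\mathbb R/2\pi\mathbb Z$. For real-valued $f$ on $\mathbb T$ write $c_k(f)=\frac1{2\pi}\int_{\mathbb T}f(x)e^{-ikx}\,dx$ and, for an integer $s\ge 1$, $\|f\|_{H^s}=\big(\|f\|_{L^2}^2+\||\partial_x|^s f\|_{L^2}^2\big)^{1/2}$, where $\||\partial_x|^s f\|_{L^2}^2=2\pi\sum_{k\in\mathbb Z}|k|^{2s}|c_k(f)|^2$. Consider the Allen–Cahn equation $\partial_t u=\nu\,\partial_{xx}u+u-u^3$ on $\mathbb T$ with $\nu>0$. For an integer $M\ge 2$ let $\Pi_M f=\sum_{|k|\le M}c_k(f)e^{ikx}$, and for $t\in\mathbb R$ let $S_L(t)=\exp(\nu t\,\partial_{xx})$, so that $\Pi_M S_L(t)f=\sum_{|k|\le M}e^{-\nu t k^2}c_k(f)e^{ikx}$. For $t\in\mathbb R$ (of either sign) let $S_N(t)f=w(t)$, where $w$ is the pointwise solution of $\partial_s w=w-w^3$, $w|_{s=0}=f$; for $t<0$, $S_N(t)f$ is defined only if this solution exists on all of $[t,0]$ at every point of $\mathbb T$. Put $$S^{(2)}(t)=\Pi_M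 S_L(\tfrac t2)\,S_N(t)\,\Pi_M S_L(\tfrac t2),\qquad S^{(4)}(\tau)=S^{(2)}(x_1\tau)\,S^{(2)}(-x_0\tau)\,S^{(2)}(x_1\tau),$$ $$x_0=\frac{2^{1/3}}{2-2^{1/3}},\qquad x_1=\frac1{2-2^{1/3}}.$$ **Theorem.** There are positive quantities $\tau_*=\tau_*(l_0,\gamma,\nu)$ and $A_1=A_1(R,\nu,l_0,k_0)$, depending only on the arguments shown, such that the following holds for all $\nu>0$, $l_0>0$, all integers $M\ge2$ and all $a\in H^1(\mathbb T)$. If $0<\tau\le l_0M^{-2}$ and $\tau\le\tau_*(l_0,\|a\|_{H^1},\nu)$, then the iterates $u^0=\Pi_M a$, $u^{n+1}=S^{(4)}(\tau)u^n$ $(n\ge0)$ are well defined for all $n$, and for every integer $k_0\ge1$ $$\sup_{n\ge0}\|u^n\|_{H^{k_0}}\le A_1\big(\|u^0\|_{H^{k_0}},\nu,l_0,k_0\big)<\infty .$$ In particular the bound is uniform in $n$, and it depends on $M$ and $\tau$ only through $\|u^0\|_{H^{k_0}}$. -/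

import Mathlib

noncomputable section

namespace AllenCahn

/-- The one-dimensional `2π`-periodic torus `ℝ / 2πℤ`; its `volume` has total mass `2π`. -/
abbrev Torus : Type := AddCircle (2 * Real.pi)

instance factTwoPiPos : Fact (0 < 2 * Real.pi) := ⟨Real.two_pi_pos⟩

/-- The Fourier coefficient `(2π)⁻¹ ∫ f(x) exp (-i k x) dx` of a real-valued function `f`. -/
def coeff (f : Torus → ℝ) (k : ℤ) : ℂ := fourierCoeff (fun x => (f x : ℂ)) k

/-- Membership in the Sobolev space `H^s(𝕋)`, `s` a nonnegative integer: `f ∈ L²` and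
`|∇|^s f ∈ L²`. -/
def MemSobolev (s : ℕ) (f : Torus → ℝ) : Prop :=
  MeasureTheory.MemLp f 2 MeasureTheory.volume ∧
    Summable fun k : ℤ => |(k : ℝ)| ^ (2 * s) * ‖coeff f k‖ ^ 2

/-- The norm `‖f‖_{H^s} = (‖f‖_{L²}² + ‖|∇|^s f‖_{L²}²)^{1/2}`, where by Parseval
`‖|∇|^s f‖_{L²}² = 2π ∑ |k|^{2s} |c_k|²` with `c_k` the coefficients above. -/
def sobolevNorm (s : ℕ) (f : Torus → ℝ) : ℝ :=
  Real.sqrt ((∫ x, f x ^ 2) +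
    2 * Real.pi * ∑' k : ℤ, |(k : ℝ)| ^ (2 * s) * ‖coeff f k‖ ^ 2)

/-- The function `∑_{|k| ≤ M} c_k exp (i k x)`. The sum is real whenever
`c_{-k}` is the conjugate of `c_k`, which is the case in all uses below. -/
def truncSum (M : ℕ) (c : ℤ → ℂ) (x : Torus) : ℝ :=
  (∑ k ∈ Finset.Icc (-(M : ℤ)) (M : ℤ), c k * fourier k x).re

/-- The spectral truncation `Π_M f`. -/
def proj (M : ℕ) (f : Torus → ℝ) : Torus → ℝ := truncSum M (coeff f)

/-- The Fourier coefficients `exp (-ν t k²) c_k` of `S_L(t) f = exp (ν t ∂_xx) f`. For `t < 0`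
they need not be the coefficients of a function, so `S_L(t)` is only used below `Π_M`. -/
def heatCoeff (ν t : ℝ) (f : Torus → ℝ) (k : ℤ) : ℂ :=
  (Real.exp (-(ν * t * (k : ℝ) ^ 2)) : ℂ) * coeff f k

/-- The operator `Π_M S_L(t)`, for `t` of either sign. -/
def projHeat (ν : ℝ) (M : ℕ) (t : ℝ) (f : Torus → ℝ) : Torus → ℝ :=
  truncSum M (heatCoeff ν t f)

/-- `b = S_N(t) a`: at every point of the torus, the solution of `∂_t w = w - w³` with initial value
`a` exists on the whole closed time interval between `0` and `t`, and its value at time `t` is `b`.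
For `t < 0` the solution can blow up; then no `b` is related to `a`. -/
def IsNonlinearFlow (t : ℝ) (a b : Torus → ℝ) : Prop :=
  ∃ w : ℝ → Torus → ℝ,
    (∀ x, w 0 x = a x) ∧
    (∀ x, ∀ s ∈ Set.uIcc 0 t,
      HasDerivWithinAt (fun r => w r x) (w s x - w s x ^ 3) (Set.uIcc 0 t) s) ∧
    ∀ x, w t x = b x

/-- `g = S⁽²⁾(t) f`, where `S⁽²⁾(t) = Π_M S_L(t/2) S_N(t) Π_M S_L(t/2)`. -/
def IsStep2 (ν : ℝ) (M : ℕ) (t : ℝ) (f g : Torus → ℝ) : Prop :=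
  ∃ w, IsNonlinearFlow t (projHeat ν M (t / 2) f) w ∧ g = projHeat ν M (t / 2) w

/-- The constant `x₀ = 2^{1/3} / (2 - 2^{1/3})`. -/
def x₀ : ℝ := (2 : ℝ) ^ ((1 : ℝ) / 3) / (2 - (2 : ℝ) ^ ((1 : ℝ) / 3))

/-- The constant `x₁ = 1 / (2 - 2^{1/3})`. -/
def x₁ : ℝ := 1 / (2 - (2 : ℝ) ^ ((1 : ℝ) / 3))

/-- `g = S⁽⁴⁾(τ) f`, where `S⁽⁴⁾(τ) = S⁽²⁾(x₁ τ) S⁽²⁾(-x₀ τ) S⁽²⁾(x₁ τ)`. -/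
def IsStep4 (ν : ℝ) (M : ℕ) (τ : ℝ) (f g : Torus → ℝ) : Prop :=
  ∃ f₁ f₂, IsStep2 ν M (x₁ * τ) f f₁ ∧ IsStep2 ν M (-x₀ * τ) f₁ f₂ ∧ IsStep2 ν M (x₁ * τ) f₂ g

/-- `u` is a sequence of iterates: `u⁰ = Π_M a` and `u^{n+1} = S⁽⁴⁾(τ) uⁿ` for all `n`. -/
def IsIterates (ν : ℝ) (M : ℕ) (τ : ℝ) (a : Torus → ℝ) (u : ℕ → Torus → ℝ) : Prop :=
  u 0 = proj M a ∧ ∀ n, IsStep4 ν M τ (u n) (u (n + 1))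

end AllenCahn

end

/-! Only the Fourier coefficients with |k| ≤ M matter. On them a step combines diagonal multipliers
`fac θ z`, z = ντk², with the increments `incr` of the scalar flow. The obstacle is the middle
substep, which runs backward: the inverse heat flow is unbounded and the ODE may blow up. The
condition τM² ≤ l gives z ≤ νl, so backward multipliers are bounded uniformly in M; a bound in H¹,
hence in sup norm, keeps the trajectories of the ODE alive for small τ. Moreover, once the exponents
of a full step are added up (`step4_apply`), no backward multiplier remains.

The H¹ bound is an energy estimate. The three increments are x₁τ, −x₀τ, x₁τ times u − u³, up to
deviations whose squared norm is of size τ⁴ + τ²·`dissip` (`exists_inc_sub_bounds`). As x₁ − x₀ + x₁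
= 1, first-order consistency suffices. With Y the squared H¹ norm and m the squared L² norm (both
normalised), the cubic contributes at most 2τ(Y − m²) (`sum_cubic_le`) and the heat flow a negative
multiple of `dissip`. Part of the dissipation absorbs the deviations; the rest damps high
frequencies, while m² damps low ones (`damping_le`). For Y ≤ B and τ small in terms of B, the new
value of Y is at most Y + τ(L − Y), with L = `absorbLevel` independent of the data. Hence max(Y, L)
never grows (`exists_step_bound`), and one choice of τ serves every n.

Higher norms follow by induction on the order. If order s is bounded, the increments are O(τ) in
that norm, and the diffusion trades one derivative for a factor 1/(ντ) on their squares
(`hNorm_step4_le`). Production of order τ per step then faces damping of order τ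
(`exists_hNorm_succ_bound`). This needs no further restriction on τ, so the time step does not
depend on k₀. -/

noncomputable section

namespace AllenCahn

/-! ### Fourier analysis on the torus and truncated Sobolev norms -/

section

open MeasureTheory AddCircle

/-- The mean value of a function on the torus. -/
def avg (f : Torus → ℝ) : ℝ := ∫ x, f x ∂haarAddCircle

lemma integral_eq_avg (f : Torus → ℝ) : ∫ x, f x = 2 * Real.pi * avg f := by
  rw [avg, integral_haarAddCircle, smul_eq_mul, mul_inv_cancel_left₀ Real.two_pi_pos.ne']

lemma integrable_haar {E : Type*} [NormedAddCommGroup E] {f : Torus → E} (hf : Continuous f) :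
    Integrable f haarAddCircle :=
  hf.integrable_of_hasCompactSupport (HasCompactSupport.of_compactSpace f)

lemma avg_mono {f g : Torus → ℝ} (hf : Continuous f) (hg : Continuous g) (h : ∀ x, f x ≤ g x) :
    avg f ≤ avg g :=
  integral_mono (integrable_haar hf) (integrable_haar hg) h

lemma avg_add {f g : Torus → ℝ} (hf : Continuous f) (hg : Continuous g) :
    avg (fun x => f x + g x) = avg f + avg g :=
  integral_add (integrable_haar hf) (integrable_haar hg)

lemma avg_const_mul (c : ℝ) (f : Torus → ℝ) : avg (fun x => c * f x) = c * avg f :=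
  integral_const_mul c f

lemma avg_const (c : ℝ) : avg (fun _ => c) = c := by simp [avg]

/-- Coefficient sequences of real-valued functions. -/
def Herm (c : ℤ → ℂ) : Prop := ∀ k, c (-k) = starRingEnd ℂ (c k)

lemma herm_coeff (f : Torus → ℝ) : Herm (coeff f) := by
  intro k
  unfold coeff fourierCoeff
  rw [← integral_conj]
  congr 1; ext x
  rw [smul_eq_mul, smul_eq_mul, map_mul, Complex.conj_ofReal, ← fourier_neg]

lemma Herm.add {c d : ℤ → ℂ} (hc : Herm c) (hd : Herm d) : Herm (fun k => c k + d k) := by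
  intro k; simp only [map_add]; rw [hc, hd]

lemma Herm.sub {c d : ℤ → ℂ} (hc : Herm c) (hd : Herm d) : Herm (fun k => c k - d k) := by
  intro k; simp only [map_sub]; rw [hc, hd]

lemma Herm.real_mul {c : ℤ → ℂ} (hc : Herm c) {m : ℤ → ℝ} (hm : ∀ k, m (-k) = m k) :
    Herm (fun k => (m k : ℂ) * c k) := by
  intro k; simp only [map_mul, Complex.conj_ofReal]; rw [hc, hm]

/-- The coefficient sequence of the derivative. -/
def diffCoeff (c : ℤ → ℂ) : ℤ → ℂ := fun k => Complex.I * k * c k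

lemma Herm.diffCoeff {c : ℤ → ℂ} (hc : Herm c) : Herm (diffCoeff c) := by
  intro k; simp only [AllenCahn.diffCoeff, map_mul, Complex.conj_I]; rw [hc]; push_cast
  simp

lemma Herm.diffCoeff_iterate {c : ℤ → ℂ} (hc : Herm c) (i : ℕ) : Herm (AllenCahn.diffCoeff^[i] c) := by
  induction i with
  | zero => exact hc
  | succ i ih => rw [Function.iterate_succ_apply']; exact ih.diffCoeff

lemma norm_sq_diffCoeff_iterate (c : ℤ → ℂ) (i : ℕ) (k : ℤ) :
    ‖diffCoeff^[i] c k‖ ^ 2 = (k : ℝ) ^ (2 * i) * ‖c k‖ ^ 2 := by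
  induction i with
  | zero => simp
  | succ i ih =>
    rw [Function.iterate_succ_apply', diffCoeff, norm_mul, norm_mul, mul_pow, ih]
    simp
    ring

lemma truncSum_congr {M : ℕ} {c d : ℤ → ℂ}
    (h : ∀ k ∈ Finset.Icc (-(M : ℤ)) M, c k = d k) : truncSum M c = truncSum M d := by
  ext x; unfold truncSum; rw [Finset.sum_congr rfl]; intro k hk; rw [h k hk]

lemma ofReal_truncSum {c : ℤ → ℂ} (hc : Herm c) (M : ℕ) (x : Torus) :
    (truncSum M c x : ℂ) = ∑ k ∈ Finset.Icc (-(M : ℤ)) (M : ℤ), c k * fourier k x := by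
  unfold truncSum
  rw [← Complex.conj_eq_iff_re, map_sum]
  refine Finset.sum_nbij' (fun k => -k) (fun k => -k) ?_ ?_ ?_ ?_ ?_
  · intro k hk; simp only [Finset.mem_Icc] at *; omega
  · intro k hk; simp only [Finset.mem_Icc] at *; omega
  · simp
  · simp
  · intro k _; rw [map_mul, hc, fourier_neg]

lemma continuous_truncSum (M : ℕ) (c : ℤ → ℂ) : Continuous (truncSum M c) := by
  unfold truncSum
  refine Complex.continuous_re.comp (continuous_finsetSum _ fun k _ => ?_)
  exact continuous_const.mul (fourier k).continuous

lemma truncSum_sub (M : ℕ) (c d : ℤ → ℂ) (x : Torus) :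
    truncSum M (fun k => c k - d k) x = truncSum M c x - truncSum M d x := by
  simp only [truncSum, sub_mul, Finset.sum_sub_distrib, Complex.sub_re]

lemma hasDerivAt_truncSum (M : ℕ) (c : ℤ → ℂ) (x : ℝ) :
    HasDerivAt (fun y : ℝ => truncSum M c (y : Torus)) (truncSum M (diffCoeff c) (x : Torus)) x := by
  have h : HasDerivAt (fun y : ℝ => ∑ k ∈ Finset.Icc (-(M : ℤ)) (M : ℤ),
      c k * fourier k (y : Torus))
      (∑ k ∈ Finset.Icc (-(M : ℤ)) (M : ℤ), diffCoeff c k * fourier k (x : Torus)) x := by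
    refine HasDerivAt.fun_sum fun k _ => ?_
    have := (hasDerivAt_fourier (2 * Real.pi) k x).const_mul (c k)
    refine this.congr_deriv ?_
    have hpi : (Real.pi : ℂ) ≠ 0 := by exact_mod_cast Real.pi_ne_zero
    simp only [diffCoeff]; push_cast
    field_simp
  exact (Complex.reCLM.hasFDerivAt.comp_hasDerivAt x h)

lemma iteratedDeriv_truncSum (M : ℕ) (c : ℤ → ℂ) (i : ℕ) :
    iteratedDeriv i (fun y : ℝ => truncSum M c (y : Torus)) =
      fun y : ℝ => truncSum M (diffCoeff^[i] c) (y : Torus) := by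
  induction i with
  | zero => simp
  | succ i ih =>
    rw [iteratedDeriv_succ, ih]
    ext x
    rw [(hasDerivAt_truncSum M _ x).deriv, Function.iterate_succ_apply']

lemma contDiff_truncSum (M : ℕ) (c : ℤ → ℂ) (n : ℕ∞) :
    ContDiff ℝ n (fun y : ℝ => truncSum M c (y : Torus)) := by
  refine contDiff_of_differentiable_iteratedDeriv fun m _ => ?_
  rw [iteratedDeriv_truncSum]
  exact fun x => (hasDerivAt_truncSum M _ x).differentiableAt

lemma coeff_truncSum {c : ℤ → ℂ} (hc : Herm c) {M : ℕ} {k : ℤ} (hk : k ∈ Finset.Icc (-(M : ℤ)) M) :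
    coeff (truncSum M c) k = c k := by
  have h : (fun x => (truncSum M c x : ℂ)) =
      ∑ j ∈ Finset.Icc (-(M : ℤ)) (M : ℤ), fun x => c j * fourier j x := by
    ext x; rw [ofReal_truncSum hc, Finset.sum_apply]
  rw [coeff, h, fourierCoeff.sum _ (fun j x => c j * fourier j x) fun j _ =>
    integrable_haar (continuous_const.mul (fourier j).continuous), Finset.sum_apply]
  simp_rw [fourierCoeff.const_mul, fourierCoeff_fourier]
  rw [Finset.sum_eq_single k]
  · simp
  · intro j _ hj; simp [hj.symm]
  · exact fun h => absurd hk h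

lemma coeff_truncSum_of_notMem {c : ℤ → ℂ} (hc : Herm c) {M : ℕ} {k : ℤ}
    (hk : k ∉ Finset.Icc (-(M : ℤ)) M) : coeff (truncSum M c) k = 0 := by
  have h : (fun x => (truncSum M c x : ℂ)) =
      ∑ j ∈ Finset.Icc (-(M : ℤ)) (M : ℤ), fun x => c j * fourier j x := by
    ext x; rw [ofReal_truncSum hc, Finset.sum_apply]
  rw [coeff, h, fourierCoeff.sum _ (fun j x => c j * fourier j x) fun j _ =>
    integrable_haar (continuous_const.mul (fourier j).continuous), Finset.sum_apply]
  simp_rw [fourierCoeff.const_mul, fourierCoeff_fourier]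
  refine Finset.sum_eq_zero fun j hj => ?_
  have : k ≠ j := fun h => hk (h ▸ hj)
  simp [this]

lemma coeff_add {f g : Torus → ℝ} (hf : Continuous f) (hg : Continuous g) (k : ℤ) :
    coeff (fun x => f x + g x) k = coeff f k + coeff g k := by
  have := congrFun (fourierCoeff.add
    (f := fun x => (f x : ℂ)) (g := fun x => (g x : ℂ))
    (integrable_haar (Complex.continuous_ofReal.comp hf))
    (integrable_haar (Complex.continuous_ofReal.comp hg))) k
  rw [coeff, coeff, coeff]
  convert this using 2
  · ext x; simp
  · rfl

lemma coeff_const_mul (a : ℝ) (f : Torus → ℝ) (k : ℤ) :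
    coeff (fun x => a * f x) k = a * coeff f k := by
  rw [coeff, coeff, ← fourierCoeff.const_mul]; congr 1; ext x; push_cast; rfl

lemma coeff_sub {f g : Torus → ℝ} (hf : Continuous f) (hg : Continuous g) (k : ℤ) :
    coeff (fun x => f x - g x) k = coeff f k - coeff g k := by
  have h := coeff_add (hf.sub hg) hg k
  simp only [Pi.sub_apply, sub_add_cancel] at h
  exact eq_sub_of_add_eq h.symm

/-- Parseval's identity. -/
lemma hasSum_norm_sq_coeff {f : Torus → ℝ} (hf : MemLp f 2 volume) :
    HasSum (fun k => ‖coeff f k‖ ^ 2) (avg fun x => f x ^ 2) := by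
  have h1 : MemLp (fun x => (f x : ℂ)) 2 haarAddCircle := hf.ofReal.haarAddCircle
  have h := hasSum_sq_fourierCoeff h1.toLp
  have h2 : fourierCoeff (h1.toLp : Torus → ℂ) = coeff f := by
    exact fourierCoeff_congr_ae h1.coeFn_toLp
  rw [h2] at h
  convert h using 1
  refine integral_congr_ae ?_
  filter_upwards [h1.coeFn_toLp] with x hx
  rw [hx]; simp

lemma memLp_of_continuous {f : Torus → ℝ} (hf : Continuous f) : MemLp f 2 volume := by
  obtain ⟨C, hC⟩ := isCompact_univ.exists_bound_of_continuousOn hf.continuousOn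
  exact MemLp.of_bound hf.aestronglyMeasurable C (Filter.Eventually.of_forall fun x => hC x trivial)

lemma bessel {f : Torus → ℝ} (hf : MemLp f 2 volume) (S : Finset ℤ) :
    ∑ k ∈ S, ‖coeff f k‖ ^ 2 ≤ avg fun x => f x ^ 2 :=
  sum_le_hasSum S (fun _ _ => by positivity) (hasSum_norm_sq_coeff hf)

/-- The squared homogeneous Sobolev norm of order `s` of the truncation to frequencies `≤ M`. -/
def hNorm (M s : ℕ) (c : ℤ → ℂ) : ℝ :=
  ∑ k ∈ Finset.Icc (-(M : ℤ)) (M : ℤ), (k : ℝ) ^ (2 * s) * ‖c k‖ ^ 2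

lemma even_pow_nonneg (k : ℝ) (s : ℕ) : 0 ≤ k ^ (2 * s) := by rw [pow_mul]; positivity

lemma hNorm_nonneg (M s : ℕ) (c : ℤ → ℂ) : 0 ≤ hNorm M s c :=
  Finset.sum_nonneg fun k _ => mul_nonneg (even_pow_nonneg _ _) (by positivity)

lemma hNorm_diffCoeff_iterate (M s i : ℕ) (c : ℤ → ℂ) :
    hNorm M s (diffCoeff^[i] c) = hNorm M (s + i) c := by
  unfold hNorm
  refine Finset.sum_congr rfl fun k _ => ?_
  rw [norm_sq_diffCoeff_iterate]; ring

lemma hNorm_diffCoeff (M s : ℕ) (c : ℤ → ℂ) : hNorm M s (diffCoeff c) = hNorm M (s + 1) c :=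
  hNorm_diffCoeff_iterate M s 1 c

lemma hNorm_mono_order (M : ℕ) {s r : ℕ} (hs : 1 ≤ s) (h : s ≤ r) (c : ℤ → ℂ) :
    hNorm M s c ≤ hNorm M r c := by
  refine Finset.sum_le_sum fun k _ => mul_le_mul_of_nonneg_right ?_ (by positivity)
  rw [pow_mul, pow_mul]
  rcases eq_or_ne k 0 with rfl | hk
  · have : r ≠ 0 := by omega
    have : s ≠ 0 := by omega
    simp [*]
  · refine pow_le_pow_right₀ ?_ h
    have : (1 : ℝ) ≤ |(k : ℝ)| := by exact_mod_cast Int.one_le_abs hk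
    rw [← sq_abs]; nlinarith

lemma avg_truncSum_sq {c : ℤ → ℂ} (hc : Herm c) (M : ℕ) :
    avg (fun x => truncSum M c x ^ 2) = hNorm M 0 c := by
  refine (hasSum_norm_sq_coeff (memLp_of_continuous (continuous_truncSum M c))).unique ?_
  have : hNorm M 0 c = ∑ k ∈ Finset.Icc (-(M : ℤ)) (M : ℤ), ‖coeff (truncSum M c) k‖ ^ 2 := by
    refine Finset.sum_congr rfl fun k hk => ?_
    rw [coeff_truncSum hc hk]; simp
  rw [this]
  refine hasSum_sum_of_ne_finset_zero fun k hk => ?_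
  rw [coeff_truncSum_of_notMem hc hk]; simp

lemma avg_truncSum_mul {c : ℤ → ℂ} (hc : Herm c) (M : ℕ) {g : Torus → ℝ} (hg : Continuous g) :
    avg (fun x => truncSum M c x * g x) =
      ∑ k ∈ Finset.Icc (-(M : ℤ)) (M : ℤ), (starRingEnd ℂ (c k) * coeff g k).re := by
  have h : ((avg fun x => truncSum M c x * g x : ℝ) : ℂ) =
      ∑ k ∈ Finset.Icc (-(M : ℤ)) (M : ℤ), starRingEnd ℂ (c k) * coeff g k := by
    rw [avg, ← integral_complex_ofReal]
    have : ∀ x, ((truncSum M c x * g x : ℝ) : ℂ) = ∑ k ∈ Finset.Icc (-(M : ℤ)) (M : ℤ),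
        starRingEnd ℂ (c k) * (fourier (-k) x • (g x : ℂ)) := by
      intro x
      rw [Complex.ofReal_mul, ← Complex.conj_ofReal (truncSum M c x), ofReal_truncSum hc, map_sum,
        Finset.sum_mul]
      refine Finset.sum_congr rfl fun k _ => ?_
      rw [map_mul, fourier_neg, smul_eq_mul, mul_assoc]
    simp_rw [this]
    rw [integral_finsetSum]
    · refine Finset.sum_congr rfl fun k _ => ?_
      rw [integral_const_mul]; rfl
    · intro k _
      refine integrable_haar (continuous_const.mul ?_)
      exact (fourier (-k)).continuous.smul (Complex.continuous_ofReal.comp hg)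
  have := congrArg Complex.re h
  rwa [Complex.ofReal_re, Complex.re_sum] at this

lemma coeff_of_hasDerivAt {g g' : Torus → ℝ} (hg' : Continuous g')
    (h : ∀ x : ℝ, HasDerivAt (fun y : ℝ => g y) (g' x) x) (k : ℤ) :
    coeff g' k = Complex.I * k * coeff g k := by
  have hd : ∀ x : ℝ, HasDerivAt (fun y : ℝ => fourier (-k) (y : Torus) * (g y : ℂ))
      (fourier (-k) (x : Torus) * (g' x : ℂ) -
        Complex.I * k * (fourier (-k) (x : Torus) * (g x : ℂ))) x := by
    intro x
    have h1 := (hasDerivAt_fourier_neg (2 * Real.pi) k x).mul (h x).ofReal_comp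
    refine h1.congr_deriv ?_
    have hpi : (Real.pi : ℂ) ≠ 0 := by exact_mod_cast Real.pi_ne_zero
    push_cast
    field_simp
    ring
  have hcg : Continuous fun y : ℝ => (g y : ℂ) :=
    Complex.continuous_ofReal.comp (continuous_iff_continuousAt.2 fun x => (h x).continuousAt)
  have hcf : Continuous fun y : ℝ => fourier (-k) (y : Torus) :=
    (fourier (-k)).continuous.comp (AddCircle.continuous_mk' _)
  have hcg' : Continuous fun y : ℝ => (g' y : ℂ) :=
    Complex.continuous_ofReal.comp (hg'.comp (AddCircle.continuous_mk' _))
  have hi := intervalIntegral.integral_eq_sub_of_hasDerivAt (a := 0) (b := 0 + 2 * Real.pi)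
    (fun x _ => hd x) (((hcf.mul hcg').sub (continuous_const.mul (hcf.mul hcg))).intervalIntegrable _ _)
  have hi1 : Continuous fun y : ℝ => fourier (-k) (y : Torus) * (g' y : ℂ) := hcf.mul hcg'
  have hi2 : Continuous fun y : ℝ => Complex.I * k * (fourier (-k) (y : Torus) * (g y : ℂ)) :=
    continuous_const.mul (hcf.mul hcg)
  rw [intervalIntegral.integral_sub (hi1.intervalIntegrable _ _) (hi2.intervalIntegrable _ _),
    intervalIntegral.integral_const_mul] at hi
  have h0 : ((0 + 2 * Real.pi : ℝ) : Torus) = ((0 : ℝ) : Torus) := by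
    rw [zero_add]; exact AddCircle.coe_period _
  rw [h0, sub_self] at hi
  rw [coeff, coeff, fourierCoeff_eq_intervalIntegral _ k 0, fourierCoeff_eq_intervalIntegral _ k 0]
  simp only [smul_eq_mul, Complex.real_smul] at *
  linear_combination (1 / (2 * Real.pi) : ℝ) * hi

lemma periodic_iteratedDeriv {f : ℝ → ℝ} {a : ℝ} (hf : Function.Periodic f a) (n : ℕ) :
    Function.Periodic (iteratedDeriv n f) a := by
  intro x
  have h := congrFun (iteratedDeriv_comp_add_const n f a) x
  rwa [funext hf, eq_comm] at h

/-- Derivatives are taken of lifts to ℝ, while Bessel's inequality is used on the torus; by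
periodicity every derivative of the lift descends. -/
lemma exists_torus_iteratedDeriv (g : Torus → ℝ) :
    ∃ d : ℕ → Torus → ℝ, ∀ i (x : ℝ), d i x = iteratedDeriv i (fun y : ℝ => g y) x := by
  have hp : Function.Periodic (fun y : ℝ => g y) (2 * Real.pi) := fun x => by
    show g ((x + 2 * Real.pi : ℝ) : Torus) = g x
    rw [AddCircle.coe_add_period]
  exact ⟨fun i => (periodic_iteratedDeriv hp i).lift, fun i x => Function.Periodic.lift_coe _ x⟩

lemma continuous_torus_iff {g : Torus → ℝ} : Continuous g ↔ Continuous fun x : ℝ => g x :=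
  isQuotientMap_quotient_mk'.continuous_iff

/-- If the derivative of order `s` of `g` is dominated by trigonometric polynomials, then so is
the homogeneous Sobolev norm of `g`. -/
lemma hNorm_coeff_le (g : Torus → ℝ) (s M : ℕ) (hg : ContDiff ℝ s (fun x : ℝ => g x))
    {A B : ℝ} {p q : ℤ → ℂ} (hp : Herm p) (hq : Herm q)
    (h : ∀ x : ℝ, |iteratedDeriv s (fun y : ℝ => g y) x| ≤
      A * |truncSum M p x| + B * |truncSum M q x|) :
    hNorm M s (coeff g) ≤ 2 * A ^ 2 * hNorm M 0 p + 2 * B ^ 2 * hNorm M 0 q := by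
  obtain ⟨d, hd⟩ := exists_torus_iteratedDeriv g
  have hc : ∀ i ≤ s, Continuous (d i) := fun i hi => by
    rw [continuous_torus_iff]
    simp_rw [hd]
    exact hg.continuous_iteratedDeriv i (by exact_mod_cast hi)
  -- Each integration by parts contributes a factor ik, so Bessel's inequality for `d s` produces
  -- the weight k^(2s).
  have hco : ∀ i ≤ s, ∀ k, coeff (d i) k = diffCoeff^[i] (coeff g) k := by
    intro i
    induction i with
    | zero =>
      intro _ k
      have : d 0 = g := by
        ext x; induction x using QuotientAddGroup.induction_on with
        | H x => exact (hd 0 x).trans (by simp)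
      rw [this]; rfl
    | succ i ih =>
      intro hi k
      rw [Function.iterate_succ_apply', diffCoeff, ← ih (by omega)]
      refine coeff_of_hasDerivAt (hc _ hi) (fun x => ?_) k
      have hdiff := hg.differentiable_iteratedDeriv i (by exact_mod_cast hi)
      have := (hdiff x).hasDerivAt
      rw [← iteratedDeriv_succ, ← hd] at this
      simpa only [hd] using this
  have hds := hc s le_rfl
  have e1 : hNorm M s (coeff g) = ∑ k ∈ Finset.Icc (-(M : ℤ)) (M : ℤ), ‖coeff (d s) k‖ ^ 2 := by
    refine Finset.sum_congr rfl fun k _ => ?_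
    rw [hco s le_rfl, norm_sq_diffCoeff_iterate]
  rw [e1, ← avg_truncSum_sq hp, ← avg_truncSum_sq hq, ← avg_const_mul, ← avg_const_mul]
  have cp := continuous_truncSum M p
  have cq := continuous_truncSum M q
  rw [← avg_add (by fun_prop) (by fun_prop)]
  refine (bessel (memLp_of_continuous hds) _).trans (avg_mono (by fun_prop) (by fun_prop) ?_)
  intro x
  induction x using QuotientAddGroup.induction_on with
  | H x =>
    have h1 := h x
    rw [← hd] at h1
    have h2 : d s x ^ 2 ≤ (A * |truncSum M p x| + B * |truncSum M q x|) ^ 2 := by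
      rw [← sq_abs (d s x)]
      exact pow_le_pow_left₀ (abs_nonneg _) h1 2
    have h3 := sq_nonneg (A * |truncSum M p x| - B * |truncSum M q x|)
    have h4 := sq_abs (truncSum M p x)
    have h5 := sq_abs (truncSum M q x)
    show d s (x : Torus) ^ 2 ≤ 2 * A ^ 2 * truncSum M p (x : Torus) ^ 2 +
      2 * B ^ 2 * truncSum M q (x : Torus) ^ 2
    rw [← h4, ← h5]
    nlinarith

/-- The constant of the embedding of `H¹` into the bounded functions. -/
def embConst : ℝ := ∑' k : ℤ, (1 + (k : ℝ) ^ 2)⁻¹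

lemma summable_embConst : Summable fun k : ℤ => (1 + (k : ℝ) ^ 2)⁻¹ := by
  refine Summable.of_norm_bounded_eventually (g := fun k : ℤ => 1 / (k : ℝ) ^ 2)
    (Real.summable_one_div_int_pow.2 one_lt_two) ?_
  refine (Set.finite_singleton (0 : ℤ)).subset fun k hk => ?_
  by_contra h0
  apply hk
  have : (0 : ℝ) < (k : ℝ) ^ 2 := by
    have : (k : ℝ) ≠ 0 := by exact_mod_cast h0
    positivity
  show |(1 + (k : ℝ) ^ 2)⁻¹| ≤ 1 / (k : ℝ) ^ 2
  rw [abs_of_nonneg (by positivity), one_div]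
  exact inv_anti₀ this (by linarith)

lemma embConst_pos : 0 < embConst :=
  summable_embConst.tsum_pos (fun _ => by positivity) 0 (by simp)

/-- The squared `H¹` norm of the truncation to frequencies `≤ M`. -/
def yNorm (M : ℕ) (c : ℤ → ℂ) : ℝ := hNorm M 0 c + hNorm M 1 c

lemma yNorm_nonneg (M : ℕ) (c : ℤ → ℂ) : 0 ≤ yNorm M c :=
  add_nonneg (hNorm_nonneg _ _ _) (hNorm_nonneg _ _ _)

lemma yNorm_eq (M : ℕ) (c : ℤ → ℂ) :
    yNorm M c = ∑ k ∈ Finset.Icc (-(M : ℤ)) (M : ℤ), (1 + (k : ℝ) ^ 2) * ‖c k‖ ^ 2 := by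
  rw [yNorm, hNorm, hNorm, ← Finset.sum_add_distrib]
  refine Finset.sum_congr rfl fun k _ => ?_
  ring

/-- Cauchy–Schwarz with the weights (1 + k²)⁻¹ and 1 + k². The constant does not depend on M, which
is what makes all later constants uniform in M. -/
lemma truncSum_sq_le (M : ℕ) (c : ℤ → ℂ) (x : Torus) :
    truncSum M c x ^ 2 ≤ embConst * yNorm M c := by
  have h1 : |truncSum M c x| ≤ ∑ k ∈ Finset.Icc (-(M : ℤ)) (M : ℤ), ‖c k‖ := by
    refine (Complex.abs_re_le_norm _).trans ((norm_sum_le _ _).trans (Finset.sum_le_sum fun k _ => ?_))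
    rw [norm_mul, fourier_apply, Circle.norm_coe, mul_one]
  rw [← sq_abs]
  refine (pow_le_pow_left₀ (abs_nonneg _) h1 2).trans ?_
  refine (Finset.sum_sq_le_sum_mul_sum_of_sq_le_mul _ (f := fun k : ℤ => (1 + (k : ℝ) ^ 2)⁻¹)
    (g := fun k : ℤ => (1 + (k : ℝ) ^ 2) * ‖c k‖ ^ 2) (fun _ _ => by positivity)
    (fun _ _ => by positivity) ?_).trans ?_
  · intro k _
    have : (1 + (k : ℝ) ^ 2) ≠ 0 := by positivity
    rw [inv_mul_cancel_left₀ this]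
  · rw [yNorm_eq]
    exact mul_le_mul_of_nonneg_right (summable_embConst.sum_le_tsum _ fun _ _ => by positivity)
      (Finset.sum_nonneg fun _ _ => by positivity)

lemma yNorm_diffCoeff_iterate (M i : ℕ) (c : ℤ → ℂ) :
    yNorm M (diffCoeff^[i] c) = hNorm M i c + hNorm M (i + 1) c := by
  rw [yNorm, hNorm_diffCoeff_iterate, hNorm_diffCoeff_iterate, zero_add, add_comm 1]

end

/-! ### The scalar flow of w' = w − w³ -/

section

open Set

/-- The flow of `w' = w - w³`, for initial values whose trajectory exists. -/
def flow (t y : ℝ) : ℝ := Real.exp t * y / √(1 + (Real.exp (2 * t) - 1) * y ^ 2)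

/-- The times and initial values to which the explicit formula applies. -/
def flowDomain : Set (ℝ × ℝ) := {p | 0 < 1 + (Real.exp (2 * p.1) - 1) * p.2 ^ 2}

lemma isOpen_flowDomain : IsOpen flowDomain := by
  unfold flowDomain
  exact isOpen_lt continuous_const (by fun_prop)

/-- Since e^{2t} − 1 ≥ −2|t|, the radicand is at least 3/4. For t < 0 this is what excludes blow-up.
-/
lemma mem_flowDomain {t y : ℝ} (h : |t| * y ^ 2 ≤ 1 / 8) : (t, y) ∈ flowDomain := by
  show 0 < 1 + (Real.exp (2 * t) - 1) * y ^ 2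
  have h1 := Real.add_one_le_exp (2 * t)
  have h2 := neg_abs_le t
  nlinarith [sq_nonneg y]

@[simp] lemma flow_zero_time (y : ℝ) : flow 0 y = y := by simp [flow]

lemma hasDerivAt_flow {t y : ℝ} (h : (t, y) ∈ flowDomain) :
    HasDerivAt (fun r => flow r y) (flow t y - flow t y ^ 3) t := by
  have hE : 0 < 1 + (Real.exp (2 * t) - 1) * y ^ 2 := h
  have h1 : HasDerivAt (fun r : ℝ => 1 + (Real.exp (2 * r) - 1) * y ^ 2)
      (2 * Real.exp (2 * t) * y ^ 2) t := by
    have := (((((hasDerivAt_id t).const_mul 2).exp).sub_const 1).mul_const (y ^ 2)).const_add 1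
    refine this.congr_deriv ?_
    simp only [id]; ring
  have h2 := ((Real.hasDerivAt_exp t).mul_const y).div (h1.sqrt hE.ne') (Real.sqrt_ne_zero'.2 hE)
  refine h2.congr_deriv ?_
  unfold flow
  have hs := Real.sqrt_ne_zero'.2 hE
  have hs2 := Real.sq_sqrt hE.le
  have he : Real.exp (2 * t) = Real.exp t ^ 2 := by rw [← Real.exp_nat_mul]; norm_num
  set s := √(1 + (Real.exp (2 * t) - 1) * y ^ 2)
  rw [he]
  field_simp

lemma hasDerivAt_flow_space {t y : ℝ} (h : (t, y) ∈ flowDomain) :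
    HasDerivAt (flow t) (Real.exp t / √(1 + (Real.exp (2 * t) - 1) * y ^ 2) ^ 3) y := by
  have hE : 0 < 1 + (Real.exp (2 * t) - 1) * y ^ 2 := h
  have h1 : HasDerivAt (fun r : ℝ => 1 + (Real.exp (2 * t) - 1) * r ^ 2)
      ((Real.exp (2 * t) - 1) * (2 * y)) y := by
    have := (((hasDerivAt_id y).pow 2).const_mul (Real.exp (2 * t) - 1)).const_add 1
    refine this.congr_deriv ?_
    simp
  have h2 := ((hasDerivAt_id y).const_mul (Real.exp t)).div (h1.sqrt hE.ne')
    (Real.sqrt_ne_zero'.2 hE)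
  refine h2.congr_deriv ?_
  have hs := Real.sqrt_ne_zero'.2 hE
  have hs2 := Real.sq_sqrt hE.le
  set s := √(1 + (Real.exp (2 * t) - 1) * y ^ 2)
  simp only [id]
  field_simp
  rw [hs2]; ring

/-- The vector field is only locally Lipschitz, but two continuous solutions on a compact interval
stay in a common [−L, L], where 1 + 3L² is a Lipschitz constant. Times of both signs occur, hence
the two cases. -/
lemma ode_unique {f g : ℝ → ℝ} {t : ℝ}
    (hf : ∀ s ∈ uIcc 0 t, HasDerivWithinAt f (f s - f s ^ 3) (uIcc 0 t) s)
    (hg : ∀ s ∈ uIcc 0 t, HasDerivWithinAt g (g s - g s ^ 3) (uIcc 0 t) s)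
    (h0 : f 0 = g 0) : f t = g t := by
  have cf : ContinuousOn f (uIcc 0 t) := fun s hs => (hf s hs).continuousWithinAt
  have cg : ContinuousOn g (uIcc 0 t) := fun s hs => (hg s hs).continuousWithinAt
  obtain ⟨A, hA⟩ := isCompact_uIcc.exists_bound_of_continuousOn cf
  obtain ⟨B, hB⟩ := isCompact_uIcc.exists_bound_of_continuousOn cg
  set L := max (max A B) 0
  have hL : 0 ≤ L := le_max_right _ _
  have mf : ∀ s ∈ uIcc 0 t, f s ∈ Icc (-L) L := fun s hs =>
    abs_le.1 ((hA s hs).trans ((le_max_left _ _).trans (le_max_left _ _)))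
  have mg : ∀ s ∈ uIcc 0 t, g s ∈ Icc (-L) L := fun s hs =>
    abs_le.1 ((hB s hs).trans ((le_max_right _ _).trans (le_max_left _ _)))
  have hlip : LipschitzOnWith (Real.toNNReal (1 + 3 * L ^ 2)) (fun y : ℝ => y - y ^ 3)
      (Icc (-L) L) := by
    refine LipschitzOnWith.of_dist_le_mul fun x hx y hy => ?_
    rw [Real.coe_toNNReal _ (by positivity), Real.dist_eq, Real.dist_eq]
    have : x - x ^ 3 - (y - y ^ 3) = (1 - (x ^ 2 + x * y + y ^ 2)) * (x - y) := by ring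
    rw [this, abs_mul]
    refine mul_le_mul_of_nonneg_right ?_ (abs_nonneg _)
    have h1 : x ^ 2 ≤ L ^ 2 := sq_le_sq' hx.1 hx.2
    have h2 : y ^ 2 ≤ L ^ 2 := sq_le_sq' hy.1 hy.2
    rw [abs_le]
    constructor <;> nlinarith [sq_nonneg (x + y), sq_nonneg (x - y)]
  rcases le_total 0 t with ht | ht
  · rw [uIcc_of_le ht] at *
    refine ODE_solution_unique_of_mem_Icc_right (v := fun _ y => y - y ^ 3)
      (s := fun _ => Icc (-L) L) (fun _ _ => hlip) cf ?_ ?_ cg ?_ ?_ h0 (right_mem_Icc.2 ht)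
    · exact fun s hs => (hf s (Ico_subset_Icc_self hs)).mono_of_mem_nhdsWithin (Icc_mem_nhdsGE_of_mem hs)
    · exact fun s hs => mf s (Ico_subset_Icc_self hs)
    · exact fun s hs => (hg s (Ico_subset_Icc_self hs)).mono_of_mem_nhdsWithin (Icc_mem_nhdsGE_of_mem hs)
    · exact fun s hs => mg s (Ico_subset_Icc_self hs)
  · rw [uIcc_of_ge ht] at *
    refine ODE_solution_unique_of_mem_Icc_left (v := fun _ y => y - y ^ 3)
      (s := fun _ => Icc (-L) L) (fun _ _ => hlip) cf ?_ ?_ cg ?_ ?_ h0 (left_mem_Icc.2 ht)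
    · exact fun s hs => (hf s (Ioc_subset_Icc_self hs)).mono_of_mem_nhdsWithin (Icc_mem_nhdsLE_of_mem hs)
    · exact fun s hs => mf s (Ioc_subset_Icc_self hs)
    · exact fun s hs => (hg s (Ioc_subset_Icc_self hs)).mono_of_mem_nhdsWithin (Icc_mem_nhdsLE_of_mem hs)
    · exact fun s hs => mg s (Ioc_subset_Icc_self hs)

/-- Initial data whose trajectories over a time `t`, forward or backward, stay controlled. -/
def Admissible (t : ℝ) (a : Torus → ℝ) : Prop := ∀ x, |t| * a x ^ 2 ≤ 1 / 8

/-- Replaces the relation by a function; existence and uniqueness of the iterates both come from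
this equivalence. -/
lemma isNonlinearFlow_iff {t : ℝ} {a b : Torus → ℝ} (h : Admissible t a) :
    IsNonlinearFlow t a b ↔ b = fun x => flow t (a x) := by
  have hsol : ∀ x, ∀ s ∈ uIcc 0 t, HasDerivWithinAt (fun r => flow r (a x))
      (flow s (a x) - flow s (a x) ^ 3) (uIcc 0 t) s := by
    intro x s hs
    refine (hasDerivAt_flow (mem_flowDomain ?_)).hasDerivWithinAt
    have : |s| ≤ |t| := by
      have := abs_sub_left_of_mem_uIcc hs
      simpa using this
    exact (mul_le_mul_of_nonneg_right this (sq_nonneg _)).trans (h x)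
  constructor
  · rintro ⟨w, h0, hw, hb⟩
    ext x
    rw [← hb]
    exact ode_unique (hw x) (hsol x) (by simp [h0])
  · rintro rfl
    exact ⟨fun r x => flow r (a x), by simp, hsol, by simp⟩

/-! ### Expansions of the scalar flow in time, uniform on compact sets -/

section smooth

open scoped ContDiff

/-- The y-derivative is the joint Fréchet derivative applied to (0, 1), so smoothness jointly in (t,
y) is inherited. Joint smoothness is what yields uniform bounds on compact sets. -/
lemma contDiffOn_deriv_snd {g : ℝ → ℝ → ℝ} {U : Set (ℝ × ℝ)} (hU : IsOpen U)
    (hg : ContDiffOn ℝ ∞ (fun p : ℝ × ℝ => g p.1 p.2) U) :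
    ContDiffOn ℝ ∞ (fun p : ℝ × ℝ => deriv (g p.1) p.2) U := by
  have h1 : ContDiffOn ℝ ∞ (fun p => fderiv ℝ (fun p : ℝ × ℝ => g p.1 p.2) p (0, 1)) U :=
    (hg.fderiv_of_isOpen hU (by norm_num)).clm_apply contDiffOn_const
  refine h1.congr fun p hp => ?_
  have hd := ((hg.differentiableOn (by norm_num)).differentiableAt (hU.mem_nhds hp)).hasFDerivAt
  have hc : HasDerivAt (fun y : ℝ => (p.1, y)) ((0 : ℝ), (1 : ℝ)) p.2 :=
    (hasDerivAt_const _ _).prodMk (hasDerivAt_id _)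
  exact (hd.comp_hasDerivAt p.2 hc).deriv

lemma contDiffOn_iteratedDeriv_snd {g : ℝ → ℝ → ℝ} {U : Set (ℝ × ℝ)} (hU : IsOpen U)
    (hg : ContDiffOn ℝ ∞ (fun p : ℝ × ℝ => g p.1 p.2) U) (i : ℕ) :
    ContDiffOn ℝ ∞ (fun p : ℝ × ℝ => iteratedDeriv i (g p.1) p.2) U := by
  induction i with
  | zero => simpa using hg
  | succ i ih =>
    simp_rw [iteratedDeriv_succ]
    exact contDiffOn_deriv_snd (g := fun t => iteratedDeriv i (g t)) hU ih

lemma contDiffOn_deriv_fst {g : ℝ → ℝ → ℝ} {U : Set (ℝ × ℝ)} (hU : IsOpen U)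
    (hg : ContDiffOn ℝ ∞ (fun p : ℝ × ℝ => g p.1 p.2) U) :
    ContDiffOn ℝ ∞ (fun p : ℝ × ℝ => deriv (fun t => g t p.2) p.1) U ∧
      ∀ p ∈ U, HasDerivAt (fun t => g t p.2) (deriv (fun t => g t p.2) p.1) p.1 := by
  have h1 : ContDiffOn ℝ ∞ (fun p => fderiv ℝ (fun p : ℝ × ℝ => g p.1 p.2) p (1, 0)) U :=
    (hg.fderiv_of_isOpen hU (by norm_num)).clm_apply contDiffOn_const
  have h2 : ∀ p ∈ U, HasDerivAt (fun t => g t p.2)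
      (fderiv ℝ (fun p : ℝ × ℝ => g p.1 p.2) p (1, 0)) p.1 := fun p hp => by
    have hd := ((hg.differentiableOn (by norm_num)).differentiableAt (hU.mem_nhds hp)).hasFDerivAt
    have hc : HasDerivAt (fun t : ℝ => (t, p.2)) ((1 : ℝ), (0 : ℝ)) p.1 :=
      (hasDerivAt_id _).prodMk (hasDerivAt_const _ _)
    exact hd.comp_hasDerivAt p.1 hc
  exact ⟨h1.congr fun p hp => (h2 p hp).deriv, fun p hp => (h2 p hp).differentiableAt.hasDerivAt⟩

/-- Points that can be moved to time `0` within the set. -/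
def TimeStar (K : Set (ℝ × ℝ)) : Prop := ∀ p ∈ K, ∀ s ∈ uIcc 0 p.1, (s, p.2) ∈ K

lemma abs_sub_le_of_deriv {f f' : ℝ → ℝ} {t C : ℝ} (hf : ∀ s ∈ uIcc 0 t, HasDerivAt f (f' s) s)
    (hC : ∀ s ∈ uIcc 0 t, |f' s| ≤ C) : |f t - f 0| ≤ C * |t| := by
  have := (convex_uIcc (0 : ℝ) t).norm_image_sub_le_of_norm_hasDerivWithin_le
    (fun s hs => (hf s hs).hasDerivWithinAt) hC left_mem_uIcc right_mem_uIcc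
  simpa using this

/-- Mean value inequality along the segment from (0, y) to (t, y), which stays in K by `TimeStar`;
the time derivative is bounded on the compact set K. -/
lemma exists_lipschitz_time {g : ℝ → ℝ → ℝ} {U K : Set (ℝ × ℝ)} (hU : IsOpen U)
    (hg : ContDiffOn ℝ ∞ (fun p : ℝ × ℝ => g p.1 p.2) U) (hK : IsCompact K) (hKU : K ⊆ U)
    (hs : TimeStar K) : ∃ C, 0 ≤ C ∧ ∀ t y, (t, y) ∈ K → |g t y - g 0 y| ≤ C * |t| := by
  obtain ⟨h1, h2⟩ := contDiffOn_deriv_fst hU hg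
  obtain ⟨C, hC⟩ := hK.exists_bound_of_continuousOn (h1.continuousOn.mono hKU)
  refine ⟨max C 0, le_max_right _ _, fun t y hty => ?_⟩
  refine abs_sub_le_of_deriv (f := fun t => g t y) (fun s hs' => h2 (s, y) (hKU (hs _ hty s hs'))) ?_
  exact fun s hs' => (hC (s, y) (hs _ hty s hs')).trans (le_max_left _ _)

/-- The Lipschitz bound for ∂ₜg makes the derivative of r ↦ g r y − r ∂ₜg(0, y) of size |t|; the
mean value inequality supplies the second factor |t|. -/
lemma exists_quadratic_time {g : ℝ → ℝ → ℝ} {U K : Set (ℝ × ℝ)} (hU : IsOpen U)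
    (hg : ContDiffOn ℝ ∞ (fun p : ℝ × ℝ => g p.1 p.2) U) (hK : IsCompact K) (hKU : K ⊆ U)
    (hs : TimeStar K) : ∃ C, 0 ≤ C ∧ ∀ t y, (t, y) ∈ K →
      |g t y - g 0 y - t * deriv (fun r => g r y) 0| ≤ C * t ^ 2 := by
  obtain ⟨h1, h2⟩ := contDiffOn_deriv_fst hU hg
  obtain ⟨C, hC0, hC⟩ := exists_lipschitz_time (g := fun t y => deriv (fun r => g r y) t)
    hU h1 hK hKU hs
  refine ⟨C, hC0, fun t y hty => ?_⟩
  have := abs_sub_le_of_deriv (t := t) (C := C * |t|)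
    (f := fun r => g r y - r * deriv (fun r => g r y) 0)
    (f' := fun r => deriv (fun r => g r y) r - deriv (fun r => g r y) 0) (fun s hs' => ?_) ?_
  · rw [mul_assoc, abs_mul_abs_self, ← pow_two] at this
    convert this using 2
    ring
  · have := (h2 (s, y) (hKU (hs _ hty s hs'))).sub
      ((hasDerivAt_id s).mul_const (deriv (fun r => g r y) 0))
    exact this.congr_deriv (by simp)
  · intro s hs'
    refine (hC s y (hs _ hty s hs')).trans (mul_le_mul_of_nonneg_left ?_ hC0)
    simpa using abs_sub_left_of_mem_uIcc hs'

/-- The increment of the nonlinear flow. -/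
def incr (t y : ℝ) : ℝ := flow t y - y

lemma contDiffOn_incr : ContDiffOn ℝ ∞ (fun p : ℝ × ℝ => incr p.1 p.2) flowDomain := by
  unfold incr flow
  refine ContDiffOn.sub (ContDiffOn.div (by fun_prop) ?_ ?_) (by fun_prop)
  · exact ContDiffOn.sqrt (by fun_prop) fun p hp => ne_of_gt hp
  · exact fun p hp => Real.sqrt_ne_zero'.2 hp

/-- The times and values at which the flow is estimated. -/
def flowBox (L : ℝ) : Set (ℝ × ℝ) := {p | |p.1| ≤ 1 ∧ |p.2| ≤ L ∧ |p.1| * p.2 ^ 2 ≤ 1 / 8}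

lemma isCompact_flowBox (L : ℝ) : IsCompact (flowBox L) := by
  refine (isCompact_Icc (a := ((-1 : ℝ), -L)) (b := ((1 : ℝ), L))).of_isClosed_subset ?_ ?_
  · have h1 : IsClosed {p : ℝ × ℝ | |p.1| ≤ 1} := isClosed_le (by fun_prop) (by fun_prop)
    have h2 : IsClosed {p : ℝ × ℝ | |p.2| ≤ L} := isClosed_le (by fun_prop) (by fun_prop)
    have h3 : IsClosed {p : ℝ × ℝ | |p.1| * p.2 ^ 2 ≤ 1 / 8} :=
      isClosed_le (by fun_prop) (by fun_prop)
    exact h1.inter (h2.inter h3)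
  · rintro ⟨t, y⟩ ⟨h1, h2, -⟩
    exact ⟨⟨(abs_le.1 h1).1, (abs_le.1 h2).1⟩, ⟨(abs_le.1 h1).2, (abs_le.1 h2).2⟩⟩

lemma flowBox_subset (L : ℝ) : flowBox L ⊆ flowDomain := fun _ hp => mem_flowDomain hp.2.2

lemma timeStar_flowBox (L : ℝ) : TimeStar (flowBox L) := by
  rintro ⟨t, y⟩ ⟨h1, h2, h3⟩ s hs
  have : |s| ≤ |t| := by simpa using abs_sub_left_of_mem_uIcc hs
  exact ⟨this.trans h1, h2, (mul_le_mul_of_nonneg_right this (sq_nonneg _)).trans h3⟩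

/-- At time 0 the increment vanishes identically in y, so all its y-derivatives do too, and
Lipschitz dependence on time gives the factor |t|. -/
lemma exists_iteratedDeriv_incr_le (L : ℝ) (i : ℕ) :
    ∃ C, 0 ≤ C ∧ ∀ t y, (t, y) ∈ flowBox L → |iteratedDeriv i (incr t) y| ≤ C * |t| := by
  obtain ⟨C, hC0, hC⟩ := exists_lipschitz_time (g := fun t y => iteratedDeriv i (incr t) y)
    isOpen_flowDomain
    (contDiffOn_iteratedDeriv_snd (g := incr) isOpen_flowDomain contDiffOn_incr i)
    (isCompact_flowBox L) (flowBox_subset L) (timeStar_flowBox L)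
  refine ⟨C, hC0, fun t y h => ?_⟩
  have h0 : incr 0 = fun _ => 0 := by ext y; simp [incr]
  have := hC t y h
  simpa [h0, iteratedDeriv_fun_const_zero] using this

/-- Bound for all derivatives up to a given order at once. -/
lemma exists_iteratedDeriv_incr_le_of_le (L : ℝ) (n : ℕ) :
    ∃ C, 0 ≤ C ∧ ∀ i ≤ n, ∀ t y, (t, y) ∈ flowBox L → |iteratedDeriv i (incr t) y| ≤ C * |t| := by
  choose C hC0 hC using exists_iteratedDeriv_incr_le L
  refine ⟨∑ i ∈ Finset.range (n + 1), C i, Finset.sum_nonneg fun i _ => hC0 i, fun i hi t y h => ?_⟩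
  refine (hC i t y h).trans (mul_le_mul_of_nonneg_right ?_ (abs_nonneg _))
  exact Finset.single_le_sum (f := C) (fun i _ => hC0 i) (Finset.mem_range.2 (by omega))

/-- The remainder of the flow after its first-order expansion in time. -/
def rem (t y : ℝ) : ℝ := incr t y - t * (y - y ^ 3)

lemma exists_rem_le (L : ℝ) : ∃ C, 0 ≤ C ∧ ∀ t y, (t, y) ∈ flowBox L → |rem t y| ≤ C * t ^ 2 := by
  obtain ⟨C, hC0, hC⟩ := exists_quadratic_time (g := incr) isOpen_flowDomain contDiffOn_incr
    (isCompact_flowBox L) (flowBox_subset L) (timeStar_flowBox L)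
  refine ⟨C, hC0, fun t y h => ?_⟩
  have h0 : deriv (fun r => incr r y) 0 = y - y ^ 3 := by
    have := (hasDerivAt_flow (t := 0) (y := y) (mem_flowDomain (by simp))).sub_const y
    rw [flow_zero_time] at this
    exact this.deriv
  have := hC t y h
  rw [h0] at this
  simpa [incr, rem] using this

lemma differentiableAt_incr {t y : ℝ} (h : (t, y) ∈ flowDomain) : DifferentiableAt ℝ (incr t) y :=
  ((hasDerivAt_flow_space h).sub (hasDerivAt_id y)).differentiableAt

lemma hasDerivAt_rem {t y : ℝ} (h : (t, y) ∈ flowDomain) :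
    HasDerivAt (rem t) (deriv (incr t) y - t * (1 - 3 * y ^ 2)) y := by
  refine (differentiableAt_incr h).hasDerivAt.sub (HasDerivAt.const_mul t ?_)
  have := (hasDerivAt_id y).sub ((hasDerivAt_id y).pow 3)
  exact this.congr_deriv (by simp)

lemma exists_deriv_rem_le (L : ℝ) :
    ∃ C, 0 ≤ C ∧ ∀ t y, (t, y) ∈ flowBox L → |deriv (rem t) y| ≤ C * t ^ 2 := by
  obtain ⟨C, hC0, hC⟩ := exists_quadratic_time (g := fun t y => deriv (incr t) y) isOpen_flowDomain
    (contDiffOn_deriv_snd (g := incr) isOpen_flowDomain contDiffOn_incr)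
    (isCompact_flowBox L) (flowBox_subset L) (timeStar_flowBox L)
  refine ⟨C, hC0, fun t y h => ?_⟩
  have h1 := hC t y h
  have hz : deriv (incr 0) y = 0 := by
    have h0 : incr 0 = fun _ => 0 := by ext y; simp [incr]
    simp [h0]
  have h0 : deriv (fun r => deriv (incr r) y) 0 = 1 - 3 * y ^ 2 := by
    -- The closed form of the y-derivative holds only where the flow exists; validity near r = 0 is
    -- enough to differentiate there.
    have he : (fun r => deriv (incr r) y) =ᶠ[nhds 0]
        fun r => Real.exp r / √(1 + (Real.exp (2 * r) - 1) * y ^ 2) ^ 3 - 1 := by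
      have : ∀ᶠ r : ℝ in nhds 0, (r, y) ∈ flowDomain :=
        (isOpen_flowDomain.preimage (by fun_prop : Continuous fun r : ℝ => (r, y))).mem_nhds
          (mem_flowDomain (by simp))
      filter_upwards [this] with r hr
      exact ((hasDerivAt_flow_space hr).sub (hasDerivAt_id y)).deriv
    rw [he.deriv_eq]
    have h1 : HasDerivAt (fun r : ℝ => 1 + (Real.exp (2 * r) - 1) * y ^ 2) (2 * y ^ 2) 0 := by
      have := (((((hasDerivAt_id (0 : ℝ)).const_mul 2).exp).sub_const 1).mul_const
        (y ^ 2)).const_add 1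
      refine this.congr_deriv ?_
      simp
    have h2 := ((Real.hasDerivAt_exp 0).div ((h1.sqrt (by simp)).pow 3) (by simp)).sub_const 1
    refine HasDerivAt.deriv (h2.congr_deriv ?_)
    simp
  rw [(hasDerivAt_rem (flowBox_subset L h)).deriv]
  rwa [h0, hz, sub_zero] at h1

end smooth

end

/-! ### Sobolev estimates for the increments and the nonlinearity -/

section

open Set
open scoped ContDiff Nat

lemma hNorm_add_le (M s : ℕ) (c d : ℤ → ℂ) :
    hNorm M s (fun k => c k + d k) ≤ 2 * hNorm M s c + 2 * hNorm M s d := by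
  unfold hNorm
  rw [Finset.mul_sum, Finset.mul_sum, ← Finset.sum_add_distrib]
  refine Finset.sum_le_sum fun k _ => ?_
  have h1 : ‖c k + d k‖ ^ 2 ≤ 2 * ‖c k‖ ^ 2 + 2 * ‖d k‖ ^ 2 := by
    have := pow_le_pow_left₀ (norm_nonneg _) (norm_add_le (c k) (d k)) 2
    nlinarith [sq_nonneg (‖c k‖ - ‖d k‖)]
  nlinarith [mul_le_mul_of_nonneg_left h1 (even_pow_nonneg (k : ℝ) s)]

lemma hNorm_real_smul (M s : ℕ) (a : ℝ) (c : ℤ → ℂ) :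
    hNorm M s (fun k => (a : ℂ) * c k) = a ^ 2 * hNorm M s c := by
  unfold hNorm
  rw [Finset.mul_sum]
  refine Finset.sum_congr rfl fun k _ => ?_
  rw [norm_mul, Complex.norm_real, mul_pow, Real.norm_eq_abs, sq_abs]; ring

lemma yNorm_add_le (M : ℕ) (c d : ℤ → ℂ) :
    yNorm M (fun k => c k + d k) ≤ 2 * yNorm M c + 2 * yNorm M d := by
  unfold yNorm; linarith [hNorm_add_le M 0 c d, hNorm_add_le M 1 c d]

lemma yNorm_real_smul (M : ℕ) (a : ℝ) (c : ℤ → ℂ) :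
    yNorm M (fun k => (a : ℂ) * c k) = a ^ 2 * yNorm M c := by
  unfold yNorm; rw [hNorm_real_smul, hNorm_real_smul]; ring

/-- The coefficients of the constant function `1`. -/
def oneCoeff : ℤ → ℂ := fun k => if k = 0 then 1 else 0

lemma herm_oneCoeff : Herm oneCoeff := by
  intro k; unfold oneCoeff; by_cases h : k = 0 <;> simp [h]

lemma truncSum_oneCoeff (M : ℕ) (x : Torus) : truncSum M oneCoeff x = 1 := by
  unfold truncSum oneCoeff
  rw [Finset.sum_eq_single 0]
  · simp
  · intro k _ hk; simp [hk]
  · simp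

lemma hNorm_oneCoeff (M : ℕ) : hNorm M 0 oneCoeff = 1 := by
  unfold hNorm oneCoeff
  rw [Finset.sum_eq_single 0]
  · simp
  · intro k _ hk; simp [hk]
  · simp

lemma abs_truncSum_le {M : ℕ} {c : ℤ → ℂ} {B : ℝ} (h : yNorm M c ≤ B) (x : Torus) :
    |truncSum M c x| ≤ √(embConst * B) := by
  refine Real.abs_le_sqrt ((truncSum_sq_le M c x).trans ?_)
  exact mul_le_mul_of_nonneg_left h embConst_pos.le

lemma mem_flowBox {M : ℕ} {c : ℤ → ℂ} {B t : ℝ} (ht : |t| ≤ 1)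
    (ha : Admissible t (truncSum M c)) (h : yNorm M c ≤ B) (x : Torus) :
    (t, truncSum M c x) ∈ flowBox √(embConst * B) :=
  ⟨ht, abs_truncSum_le h x, ha x⟩

lemma isOpen_slice (t : ℝ) : IsOpen {y : ℝ | (t, y) ∈ flowDomain} :=
  isOpen_flowDomain.preimage (by fun_prop : Continuous fun y : ℝ => (t, y))

lemma contDiffOn_incr_slice (t : ℝ) : ContDiffOn ℝ ∞ (incr t) {y : ℝ | (t, y) ∈ flowDomain} :=
  contDiffOn_incr.comp (f := fun y : ℝ => (t, y)) (by fun_prop) fun _ hy => hy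

lemma contDiff_incr_comp {M : ℕ} {c : ℤ → ℂ} {t : ℝ} (ha : Admissible t (truncSum M c)) :
    ContDiff ℝ ∞ fun x : ℝ => incr t (truncSum M c x) := by
  rw [← contDiffOn_univ]
  exact (contDiffOn_incr_slice t).comp (contDiff_truncSum M c ⊤).contDiffOn
    fun x _ => mem_flowDomain (ha x)

lemma continuous_incr_comp {M : ℕ} {c : ℤ → ℂ} {t : ℝ} (ha : Admissible t (truncSum M c)) :
    Continuous fun x => incr t (truncSum M c x) :=
  continuous_torus_iff.2 (contDiff_incr_comp ha).continuous

/-- The chain-rule bound asks for one D whose powers D^i dominate the derivatives of order i. Lower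
derivatives are bounded by a constant b, but the top one, a, is controlled only in L². The choice D
= (b^s + a)^{1/s} lets a enter D^s linearly, hence square-integrably. -/
lemma exists_pow_scale {b a : ℝ} (hb : 1 ≤ b) (ha : 0 ≤ a) (s : ℕ) :
    ∃ D, b ≤ D ∧ D ^ s ≤ b ^ s + a ∧ (1 ≤ s → a ≤ D ^ s) := by
  rcases Nat.eq_zero_or_pos s with rfl | hs
  · exact ⟨b, le_rfl, by simpa using ha, by omega⟩
  · have h0 : 0 ≤ b ^ s + a := by positivity
    have he : ((b ^ s + a) ^ ((s : ℝ)⁻¹)) ^ s = b ^ s + a := Real.rpow_inv_natCast_pow h0 hs.ne'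
    refine ⟨(b ^ s + a) ^ ((s : ℝ)⁻¹), ?_, he.le, fun _ => ?_⟩
    · refine le_of_pow_le_pow_left₀ hs.ne' (Real.rpow_nonneg h0 _) ?_
      rw [he]; linarith
    · rw [he]; linarith [pow_nonneg (zero_le_one.trans hb) s]

/-- The increment of the flow over a time `t` is of size `t` in each Sobolev norm. -/
lemma exists_hNorm_incr_le (s : ℕ) (B : ℝ) : ∃ C, 0 ≤ C ∧ ∀ (M : ℕ) (c : ℤ → ℂ) (t : ℝ),
    Herm c → |t| ≤ 1 → Admissible t (truncSum M c) → yNorm M c ≤ B → hNorm M s c ≤ B →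
      hNorm M s (coeff fun x => incr t (truncSum M c x)) ≤ C * t ^ 2 := by
  obtain ⟨C, hC0, hC⟩ := exists_iteratedDeriv_incr_le_of_le √(embConst * B) s
  -- The sup norm of a derivative of order 1 ≤ i < s needs orders i and i + 1, each at most B. The
  -- maximum with 1 ensures D ≤ D^i.
  set b := max 1 √(embConst * (2 * B))
  have hb : 1 ≤ b := le_max_left _ _
  rcases lt_or_ge B 0 with hB | hB
  · exact ⟨0, le_rfl, fun M c t _ _ _ h _ => absurd ((yNorm_nonneg M c).trans h) (not_le.2 hB)⟩
  refine ⟨2 * (s ! * C * b ^ s) ^ 2 + 2 * (s ! * C) ^ 2 * B, by positivity, ?_⟩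
  intro M c t hc ht ha hy hs
  have hsmooth := contDiff_truncSum M c ⊤
  -- The bound splits into a constant, entered as a multiple of the trigonometric polynomial 1, and
  -- a multiple of the top derivative.
  have hbd : ∀ x : ℝ, |iteratedDeriv s (fun x : ℝ => incr t (truncSum M c x)) x| ≤
      (s ! * C * b ^ s * |t|) * |truncSum M oneCoeff x| +
        (s ! * C * |t|) * |truncSum M (diffCoeff^[s] c) x| := by
    intro x
    rw [truncSum_oneCoeff, abs_one, mul_one]
    obtain ⟨D, hD1, hD2, hD3⟩ := exists_pow_scale hb (abs_nonneg (truncSum M (diffCoeff^[s] c) x)) s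
    have key := norm_iteratedFDerivWithin_comp_le (𝕜 := ℝ) (n := s) (x := x) (C := C * |t|) (D := D)
      (contDiffOn_incr_slice t) hsmooth.contDiffOn (by exact_mod_cast le_top)
      (isOpen_slice t).uniqueDiffOn uniqueDiffOn_univ (fun x _ => mem_flowDomain (ha x))
      (mem_univ x) ?_ ?_
    · rw [iteratedFDerivWithin_univ, norm_iteratedFDeriv_eq_norm_iteratedDeriv] at key
      refine key.trans ?_
      calc (s ! : ℝ) * (C * |t|) * D ^ s
          ≤ (s ! : ℝ) * (C * |t|) * (b ^ s + |truncSum M (diffCoeff^[s] c) x|) := by gcongr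
        _ = _ := by ring
    · intro i hi
      rw [iteratedFDerivWithin_of_isOpen i (isOpen_slice t) (mem_flowDomain (ha x)),
        norm_iteratedFDeriv_eq_norm_iteratedDeriv]
      exact hC i hi t _ (mem_flowBox ht ha hy x)
    · intro i hi1 his
      rw [iteratedFDerivWithin_univ, norm_iteratedFDeriv_eq_norm_iteratedDeriv,
        iteratedDeriv_truncSum, Real.norm_eq_abs]
      rcases eq_or_lt_of_le his with rfl | hlt
      · exact hD3 hi1
      · have h1 : yNorm M (diffCoeff^[i] c) ≤ 2 * B := by
          rw [yNorm_diffCoeff_iterate]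
          linarith [hNorm_mono_order M hi1 his c, hNorm_mono_order M (by omega : 1 ≤ i + 1) hlt c]
        calc |truncSum M (diffCoeff^[i] c) x| ≤ √(embConst * (2 * B)) := abs_truncSum_le h1 _
          _ ≤ b := le_max_right _ _
          _ ≤ D := hD1
          _ ≤ D ^ i := le_self_pow₀ (hb.trans hD1) (by omega)
  have hmain := hNorm_coeff_le (fun x => incr t (truncSum M c x)) s M
    ((contDiff_incr_comp ha).of_le (by exact_mod_cast le_top)) herm_oneCoeff
    (hc.diffCoeff_iterate s) hbd
  rw [hNorm_oneCoeff, hNorm_diffCoeff_iterate, zero_add, mul_pow _ |t|, mul_pow _ |t|, sq_abs] at hmain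
  refine hmain.trans ?_
  have : 2 * ((s ! * C) ^ 2 * t ^ 2) * hNorm M s c ≤ 2 * ((s ! * C) ^ 2 * t ^ 2) * B := by gcongr
  linarith

lemma exists_yNorm_incr_le (B : ℝ) : ∃ C, 0 ≤ C ∧ ∀ (M : ℕ) (c : ℤ → ℂ) (t : ℝ),
    Herm c → |t| ≤ 1 → Admissible t (truncSum M c) → yNorm M c ≤ B →
      yNorm M (coeff fun x => incr t (truncSum M c x)) ≤ C * t ^ 2 := by
  obtain ⟨C0, h0, hC0⟩ := exists_hNorm_incr_le 0 B
  obtain ⟨C1, h1, hC1⟩ := exists_hNorm_incr_le 1 B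
  refine ⟨C0 + C1, by positivity, fun M c t hc ht ha hy => ?_⟩
  have := hC0 M c t hc ht ha hy ((le_add_of_nonneg_right (hNorm_nonneg _ _ _)).trans hy)
  have := hC1 M c t hc ht ha hy ((le_add_of_nonneg_left (hNorm_nonneg _ _ _)).trans hy)
  unfold yNorm
  linarith

/-- The nonlinearity. -/
def cubic (y : ℝ) : ℝ := y - y ^ 3

lemma continuous_cubic : Continuous cubic := by unfold cubic; fun_prop

lemma contDiff_cubic : ContDiff ℝ ∞ cubic := by unfold cubic; fun_prop

lemma hasDerivAt_cubic (y : ℝ) : HasDerivAt cubic (1 - 3 * y ^ 2) y := by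
  have := (hasDerivAt_id y).sub ((hasDerivAt_id y).pow 3)
  exact this.congr_deriv (by simp)

lemma contDiff_cubic_comp (M : ℕ) (c : ℤ → ℂ) :
    ContDiff ℝ ∞ fun x : ℝ => cubic (truncSum M c x) :=
  contDiff_cubic.comp (contDiff_truncSum M c ⊤)

lemma continuous_cubic_comp (M : ℕ) (c : ℤ → ℂ) : Continuous fun x => cubic (truncSum M c x) :=
  continuous_cubic.comp (continuous_truncSum M c)

lemma hasDerivAt_cubic_comp (M : ℕ) (c : ℤ → ℂ) (x : ℝ) :
    HasDerivAt (fun x : ℝ => cubic (truncSum M c x))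
      ((1 - 3 * truncSum M c x ^ 2) * truncSum M (diffCoeff c) x) x :=
  (hasDerivAt_cubic _).comp x (hasDerivAt_truncSum M c x)

/-- The nonlinearity is locally Lipschitz in `H¹`. -/
lemma exists_yNorm_cubic_sub_le (B : ℝ) : ∃ C, 0 ≤ C ∧ ∀ (M : ℕ) (c d : ℤ → ℂ),
    Herm c → Herm d → yNorm M c ≤ B → yNorm M d ≤ B →
      yNorm M (coeff fun x => cubic (truncSum M c x) - cubic (truncSum M d x)) ≤
        C * yNorm M (fun k => c k - d k) := by
  rcases lt_or_ge B 0 with hB | hB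
  · exact ⟨0, le_rfl, fun M c d _ _ h _ => absurd ((yNorm_nonneg M c).trans h) (not_le.2 hB)⟩
  set L := √(embConst * B)
  refine ⟨2 * (1 + 3 * L ^ 2) ^ 2 + 2 * (6 * L) ^ 2 * embConst * B,
    by have := embConst_pos; positivity, ?_⟩
  intro M c d hc hd hyc hyd
  have hL : 0 ≤ L := Real.sqrt_nonneg _
  have hcL : ∀ x, truncSum M c x ^ 2 ≤ L ^ 2 := fun x => by
    rw [← sq_abs]; exact pow_le_pow_left₀ (abs_nonneg _) (abs_truncSum_le hyc x) 2
  have hdL : ∀ x, truncSum M d x ^ 2 ≤ L ^ 2 := fun x => by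
    rw [← sq_abs]; exact pow_le_pow_left₀ (abs_nonneg _) (abs_truncSum_le hyd x) 2
  have hcd := hc.sub hd
  have hsm : ContDiff ℝ ∞ fun x : ℝ => cubic (truncSum M c x) - cubic (truncSum M d x) :=
    (contDiff_cubic_comp M c).sub (contDiff_cubic_comp M d)
  have h0 := hNorm_coeff_le (fun x => cubic (truncSum M c x) - cubic (truncSum M d x)) 0 M
    (hsm.of_le (by exact_mod_cast le_top)) (A := 1 + 3 * L ^ 2) (B := 0) hcd hcd ?_
  swap
  · intro x
    rw [iteratedDeriv_zero, truncSum_sub, zero_mul, add_zero]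
    have e : cubic (truncSum M c x) - cubic (truncSum M d x) =
        (1 - (truncSum M c x ^ 2 + truncSum M c x * truncSum M d x + truncSum M d x ^ 2)) *
          (truncSum M c x - truncSum M d x) := by unfold cubic; ring
    rw [e, abs_mul]
    refine mul_le_mul_of_nonneg_right ?_ (abs_nonneg _)
    rw [abs_le]
    constructor <;> nlinarith [hcL x, hdL x, sq_nonneg (truncSum M c x + truncSum M d x),
      sq_nonneg (truncSum M c x - truncSum M d x)]
  have h1 := hNorm_coeff_le (fun x => cubic (truncSum M c x) - cubic (truncSum M d x)) 1 M
    (hsm.of_le (by exact_mod_cast le_top)) (A := 1 + 3 * L ^ 2)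
    (B := 6 * L * √(embConst * yNorm M fun k => c k - d k)) hcd.diffCoeff hd.diffCoeff ?_
  swap
  · intro x
    rw [iteratedDeriv_one, ((hasDerivAt_cubic_comp M c x).fun_sub (hasDerivAt_cubic_comp M d x)).deriv]
    have e1 : truncSum M (diffCoeff fun k => c k - d k) x =
        truncSum M (diffCoeff c) x - truncSum M (diffCoeff d) x := by
      rw [← truncSum_sub]; congr 1; ext k; simp [diffCoeff]; ring
    -- In the last product the undifferentiated difference is estimated in sup norm, so the
    -- derivative of d is needed only in L².
    have e2 : (1 - 3 * truncSum M c x ^ 2) * truncSum M (diffCoeff c) x -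
        (1 - 3 * truncSum M d x ^ 2) * truncSum M (diffCoeff d) x =
        (1 - 3 * truncSum M c x ^ 2) * truncSum M (diffCoeff fun k => c k - d k) x -
        3 * (truncSum M c x + truncSum M d x) * (truncSum M (fun k => c k - d k) x) *
          truncSum M (diffCoeff d) x := by
      rw [e1, truncSum_sub]; ring
    rw [e2]
    refine (abs_sub _ _).trans (add_le_add ?_ ?_)
    · rw [abs_mul]
      refine mul_le_mul_of_nonneg_right ?_ (abs_nonneg _)
      rw [abs_le]
      constructor <;> nlinarith [hcL x, sq_nonneg (truncSum M c x)]
    · rw [abs_mul, abs_mul]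
      gcongr
      · rw [abs_mul, abs_of_pos (by norm_num : (0 : ℝ) < 3)]
        have := abs_add_le (truncSum M c x) (truncSum M d x)
        have := abs_truncSum_le hyc x
        have := abs_truncSum_le hyd x
        linarith
      · exact abs_truncSum_le le_rfl _
  rw [mul_pow _ √_, Real.sq_sqrt (mul_nonneg embConst_pos.le (yNorm_nonneg _ _)), hNorm_diffCoeff,
    hNorm_diffCoeff, zero_add] at h1
  have h2 : hNorm M 1 d ≤ B := (le_add_of_nonneg_left (hNorm_nonneg _ _ _)).trans hyd
  have h3 : 2 * ((6 * L) ^ 2 * (embConst * yNorm M fun k => c k - d k)) * hNorm M 1 d ≤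
      2 * ((6 * L) ^ 2 * (embConst * yNorm M fun k => c k - d k)) * B :=
    mul_le_mul_of_nonneg_left h2 (by have := embConst_pos; have := yNorm_nonneg M fun k => c k - d k; positivity)
  have h4 : yNorm M (fun k => c k - d k) =
    hNorm M 0 (fun k => c k - d k) + hNorm M 1 (fun k => c k - d k) := rfl
  rw [yNorm]
  rw [h4] at h1 h3 ⊢
  nlinarith

lemma exists_yNorm_rem_le (B : ℝ) : ∃ C, 0 ≤ C ∧ ∀ (M : ℕ) (c : ℤ → ℂ) (t : ℝ),
    Herm c → |t| ≤ 1 → Admissible t (truncSum M c) → yNorm M c ≤ B →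
      yNorm M (coeff fun x => rem t (truncSum M c x)) ≤ C * t ^ 4 := by
  rcases lt_or_ge B 0 with hB | hB
  · exact ⟨0, le_rfl, fun M c t _ _ _ h => absurd ((yNorm_nonneg M c).trans h) (not_le.2 hB)⟩
  obtain ⟨C0, hC0, h0⟩ := exists_rem_le √(embConst * B)
  obtain ⟨C1, hC1, h1⟩ := exists_deriv_rem_le √(embConst * B)
  refine ⟨2 * C0 ^ 2 + 2 * C1 ^ 2 * B, by positivity, fun M c t hc ht ha hy => ?_⟩
  have hsm : ContDiff ℝ ∞ fun x : ℝ => rem t (truncSum M c x) :=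
    (contDiff_incr_comp ha).sub (contDiff_const.mul (contDiff_cubic_comp M c))
  have g0 := hNorm_coeff_le (fun x => rem t (truncSum M c x)) 0 M
    (hsm.of_le (by exact_mod_cast le_top)) (A := C0 * t ^ 2) (B := 0) herm_oneCoeff herm_oneCoeff
    fun x => by
      rw [iteratedDeriv_zero, truncSum_oneCoeff]
      simpa using h0 t _ (mem_flowBox ht ha hy x)
  have g1 := hNorm_coeff_le (fun x => rem t (truncSum M c x)) 1 M
    (hsm.of_le (by exact_mod_cast le_top)) (A := C1 * t ^ 2) (B := 0) hc.diffCoeff hc.diffCoeff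
    fun x => by
      have hm := mem_flowBox ht ha hy (x : Torus)
      have hd := (hasDerivAt_rem (flowBox_subset _ hm)).comp x (hasDerivAt_truncSum M c x)
      have hd' : deriv (fun y : ℝ => rem t (truncSum M c y)) x =
          deriv (rem t) (truncSum M c x) * truncSum M (diffCoeff c) x := by
        rw [(hasDerivAt_rem (flowBox_subset _ hm)).deriv]; exact hd.deriv
      rw [iteratedDeriv_one, hd', abs_mul, zero_mul, add_zero]
      exact mul_le_mul_of_nonneg_right (h1 t _ hm) (abs_nonneg _)
  rw [hNorm_oneCoeff] at g0
  rw [hNorm_diffCoeff, zero_add] at g1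
  have h2 : hNorm M 1 c ≤ B := (le_add_of_nonneg_left (hNorm_nonneg _ _ _)).trans hy
  have h3 : 2 * (C1 * t ^ 2) ^ 2 * hNorm M 1 c ≤ 2 * (C1 * t ^ 2) ^ 2 * B := by gcongr
  rw [yNorm]
  nlinarith

/-- First-order consistency of the nonlinear flow in `H¹`. -/
lemma exists_yNorm_incr_sub_le (B : ℝ) : ∃ C, 0 ≤ C ∧ ∀ (M : ℕ) (c d : ℤ → ℂ) (t : ℝ),
    Herm c → Herm d → |t| ≤ 1 → Admissible t (truncSum M c) → yNorm M c ≤ B → yNorm M d ≤ B →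
      yNorm M (fun k => coeff (fun x => incr t (truncSum M c x)) k -
        t * coeff (fun x => cubic (truncSum M d x)) k) ≤
        C * (t ^ 4 + t ^ 2 * yNorm M (fun k => c k - d k)) := by
  obtain ⟨C0, hC0, h0⟩ := exists_yNorm_rem_le B
  obtain ⟨C1, hC1, h1⟩ := exists_yNorm_cubic_sub_le B
  refine ⟨2 * C0 + 2 * C1, by positivity, fun M c d t hc hd ht ha hyc hyd => ?_⟩
  -- With f the cubic, incr(c) − t f(d) = rem(c) + t (f(c) − f(d)).
  have e : (fun k => coeff (fun x => incr t (truncSum M c x)) k -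
        t * coeff (fun x => cubic (truncSum M d x)) k) = fun k =>
      coeff (fun x => rem t (truncSum M c x)) k +
        t * coeff (fun x => cubic (truncSum M c x) - cubic (truncSum M d x)) k := by
    ext k
    have hr := coeff_sub (g := fun x => t * cubic (truncSum M c x)) (continuous_incr_comp ha)
      (continuous_const.mul (continuous_cubic_comp M c)) k
    rw [coeff_const_mul] at hr
    have hr' : coeff (fun x => rem t (truncSum M c x)) k = _ := hr
    rw [hr', coeff_sub (continuous_cubic_comp M c) (continuous_cubic_comp M d)]
    ring
  rw [e]
  refine (yNorm_add_le _ _ _).trans ?_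
  rw [yNorm_real_smul]
  have a0 := h0 M c t hc ht ha hyc
  have a1 := mul_le_mul_of_nonneg_left (h1 M c d hc hd hyc hyd) (sq_nonneg t)
  have n0 : 0 ≤ t ^ 4 := by positivity
  have n1 : 0 ≤ t ^ 2 * yNorm M (fun k => c k - d k) := mul_nonneg (sq_nonneg t) (yNorm_nonneg _ _)
  nlinarith [mul_nonneg hC0 n1, mul_nonneg hC1 n0]

/-- The dissipativity of the nonlinearity in `H¹`. -/
lemma sum_cubic_le (M : ℕ) {c : ℤ → ℂ} (hc : Herm c) :
    ∑ k ∈ Finset.Icc (-(M : ℤ)) (M : ℤ), (1 + (k : ℝ) ^ 2) *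
      (starRingEnd ℂ (c k) * coeff (fun x => cubic (truncSum M c x)) k).re ≤
      yNorm M c - hNorm M 0 c ^ 2 := by
  have ct := continuous_truncSum M c
  have ctd := continuous_truncSum M (diffCoeff c)
  set g' : Torus → ℝ := fun x => (1 - 3 * truncSum M c x ^ 2) * truncSum M (diffCoeff c) x
  have cg' : Continuous g' := by fun_prop
  have e0 := avg_truncSum_mul hc M (continuous_cubic_comp M c)
  have e1 := avg_truncSum_mul hc.diffCoeff M cg'
  have e2 : ∑ k ∈ Finset.Icc (-(M : ℤ)) (M : ℤ), (1 + (k : ℝ) ^ 2) *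
      (starRingEnd ℂ (c k) * coeff (fun x => cubic (truncSum M c x)) k).re =
      avg (fun x => truncSum M c x * cubic (truncSum M c x)) +
      avg (fun x => truncSum M (diffCoeff c) x * g' x) := by
    rw [e0, e1, ← Finset.sum_add_distrib]
    refine Finset.sum_congr rfl fun k _ => ?_
    rw [coeff_of_hasDerivAt (g := fun x => cubic (truncSum M c x)) cg'
      (hasDerivAt_cubic_comp M c) k]
    have : starRingEnd ℂ (diffCoeff c k) *
        (Complex.I * k * coeff (fun x => cubic (truncSum M c x)) k) =
        ((k : ℝ) ^ 2 : ℝ) * (starRingEnd ℂ (c k) * coeff (fun x => cubic (truncSum M c x)) k) := by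
      simp only [diffCoeff, map_mul, Complex.conj_I, map_intCast]
      push_cast
      linear_combination (-(k : ℂ) ^ 2 * (starRingEnd ℂ) (c k) *
        coeff (fun x => cubic (truncSum M c x)) k) * Complex.I_sq
    rw [this, Complex.re_ofReal_mul]; ring
  rw [e2, yNorm]
  have m0 := avg_truncSum_sq hc M
  have m1 := avg_truncSum_sq hc.diffCoeff M
  rw [hNorm_diffCoeff, zero_add] at m1
  set m := hNorm M 0 c
  -- Jensen's inequality, avg u⁴ ≥ (avg u²)², in the form (u² − m)² ≥ 0.
  have b0 : avg (fun x => truncSum M c x * cubic (truncSum M c x)) ≤ m - m ^ 2 := by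
    have : avg (fun x => truncSum M c x * cubic (truncSum M c x)) ≤
        avg (fun x => (1 - 2 * m) * truncSum M c x ^ 2 + m ^ 2) := by
      refine avg_mono (ct.mul (continuous_cubic_comp M c)) (by fun_prop) fun x => ?_
      unfold cubic
      nlinarith [sq_nonneg (truncSum M c x ^ 2 - m)]
    rw [avg_add (by fun_prop) (by fun_prop), avg_const_mul, m0, avg_const] at this
    linarith
  -- After differentiation the cubic contributes −3u²(∂ₓu)², which has the favourable sign.
  have b1 : avg (fun x => truncSum M (diffCoeff c) x * g' x) ≤ hNorm M 1 c := by
    rw [← m1]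
    refine avg_mono (by fun_prop) (by fun_prop) fun x => ?_
    show truncSum M (diffCoeff c) x *
      ((1 - 3 * truncSum M c x ^ 2) * truncSum M (diffCoeff c) x) ≤ _
    nlinarith [sq_nonneg (truncSum M (diffCoeff c) x * truncSum M c x)]
  linarith

end

/-! ### The scheme as a map on Fourier coefficients -/

section

open Set

/-- The action of the heat semigroup on coefficient sequences. -/
def mult (ν s : ℝ) (c : ℤ → ℂ) : ℤ → ℂ := fun k => (Real.exp (-(ν * s * (k : ℝ) ^ 2)) : ℂ) * c k

lemma Herm.mult {c : ℤ → ℂ} (hc : Herm c) (ν s : ℝ) : Herm (mult ν s c) :=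
  hc.real_mul (m := fun k : ℤ => Real.exp (-(ν * s * (k : ℝ) ^ 2))) (by intro k; simp)

/-- The coefficients of the increment of the nonlinear flow. -/
def incrCoeff (M : ℕ) (t : ℝ) (c : ℤ → ℂ) : ℤ → ℂ := coeff fun x => incr t (truncSum M c x)

lemma herm_incrCoeff (M : ℕ) (t : ℝ) (c : ℤ → ℂ) : Herm (incrCoeff M t c) := herm_coeff _

/-- The second order step in terms of coefficients. -/
def step2 (ν : ℝ) (M : ℕ) (t : ℝ) (c : ℤ → ℂ) : ℤ → ℂ :=
  mult ν (t / 2) fun k => mult ν (t / 2) c k + incrCoeff M t (mult ν (t / 2) c) k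

lemma herm_step2 {c : ℤ → ℂ} (hc : Herm c) (ν : ℝ) (M : ℕ) (t : ℝ) : Herm (step2 ν M t c) :=
  ((hc.mult _ _).add (herm_incrCoeff _ _ _)).mult _ _

lemma projHeat_eq (ν : ℝ) (M : ℕ) (t : ℝ) (f : Torus → ℝ) :
    projHeat ν M t f = truncSum M (mult ν t (coeff f)) := rfl

lemma projHeat_truncSum {c : ℤ → ℂ} (hc : Herm c) (ν : ℝ) (M : ℕ) (t : ℝ) :
    projHeat ν M t (truncSum M c) = truncSum M (mult ν t c) := by
  rw [projHeat_eq]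
  exact truncSum_congr fun k hk => by rw [mult, mult, coeff_truncSum hc hk]

/-- Writing the flow as identity plus increment keeps the linear part an exact multiplier.
Coefficient sequences are never truncated: values at |k| > M are meaningless, but `truncSum` and all
the norms ignore them. -/
lemma isStep2_iff {c : ℤ → ℂ} (hc : Herm c) {ν : ℝ} {M : ℕ} {t : ℝ}
    (ha : Admissible t (truncSum M (mult ν (t / 2) c))) (g : Torus → ℝ) :
    IsStep2 ν M t (truncSum M c) g ↔ g = truncSum M (step2 ν M t c) := by
  have key : projHeat ν M (t / 2) (fun x => flow t (truncSum M (mult ν (t / 2) c) x)) =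
      truncSum M (step2 ν M t c) := by
    rw [projHeat_eq]
    refine truncSum_congr fun k hk => ?_
    have e : (fun x => flow t (truncSum M (mult ν (t / 2) c) x)) = fun x =>
        truncSum M (mult ν (t / 2) c) x + incr t (truncSum M (mult ν (t / 2) c) x) := by
      ext x; simp [incr]
    rw [e, step2, mult, mult, coeff_add (continuous_truncSum _ _) (continuous_incr_comp ha),
      coeff_truncSum (hc.mult _ _) hk]
    rfl
  unfold IsStep2
  rw [projHeat_truncSum hc]
  constructor
  · rintro ⟨w, hw, rfl⟩
    rw [(isNonlinearFlow_iff ha).1 hw, key]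
  · rintro rfl
    exact ⟨_, (isNonlinearFlow_iff ha).2 rfl, key.symm⟩

/-- The fourth order step in terms of coefficients. -/
def step4 (ν : ℝ) (M : ℕ) (τ : ℝ) (c : ℤ → ℂ) : ℤ → ℂ :=
  step2 ν M (x₁ * τ) (step2 ν M (-x₀ * τ) (step2 ν M (x₁ * τ) c))

lemma herm_step4 {c : ℤ → ℂ} (hc : Herm c) (ν : ℝ) (M : ℕ) (τ : ℝ) : Herm (step4 ν M τ c) :=
  herm_step2 (herm_step2 (herm_step2 hc _ _ _) _ _ _) _ _ _

/-- The data to which the nonlinear flow is applied in the first substep. -/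
def stage1 (ν τ : ℝ) (c : ℤ → ℂ) : ℤ → ℂ := mult ν (x₁ * τ / 2) c

/-- The data to which the nonlinear flow is applied in the second substep. -/
def stage2 (ν : ℝ) (M : ℕ) (τ : ℝ) (c : ℤ → ℂ) : ℤ → ℂ :=
  mult ν (-x₀ * τ / 2) (step2 ν M (x₁ * τ) c)

/-- The data to which the nonlinear flow is applied in the third substep. -/
def stage3 (ν : ℝ) (M : ℕ) (τ : ℝ) (c : ℤ → ℂ) : ℤ → ℂ :=
  mult ν (x₁ * τ / 2) (step2 ν M (-x₀ * τ) (step2 ν M (x₁ * τ) c))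

/-- The increment in the first substep. -/
def inc1 (ν : ℝ) (M : ℕ) (τ : ℝ) (c : ℤ → ℂ) : ℤ → ℂ := incrCoeff M (x₁ * τ) (stage1 ν τ c)

/-- The increment in the second substep. -/
def inc2 (ν : ℝ) (M : ℕ) (τ : ℝ) (c : ℤ → ℂ) : ℤ → ℂ := incrCoeff M (-x₀ * τ) (stage2 ν M τ c)

/-- The increment in the third substep. -/
def inc3 (ν : ℝ) (M : ℕ) (τ : ℝ) (c : ℤ → ℂ) : ℤ → ℂ := incrCoeff M (x₁ * τ) (stage3 ν M τ c)

/-- All three substeps are applied to data whose trajectories stay controlled. -/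
structure StepAdmissible (ν : ℝ) (M : ℕ) (τ : ℝ) (c : ℤ → ℂ) : Prop where
  first : Admissible (x₁ * τ) (truncSum M (stage1 ν τ c))
  second : Admissible (-x₀ * τ) (truncSum M (stage2 ν M τ c))
  third : Admissible (x₁ * τ) (truncSum M (stage3 ν M τ c))

lemma isStep4_iff {c : ℤ → ℂ} (hc : Herm c) {ν : ℝ} {M : ℕ} {τ : ℝ}
    (ha : StepAdmissible ν M τ c) (g : Torus → ℝ) :
    IsStep4 ν M τ (truncSum M c) g ↔ g = truncSum M (step4 ν M τ c) := by
  have h1 := isStep2_iff hc ha.first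
  have h2 := isStep2_iff (herm_step2 hc _ _ _) ha.second
  have h3 := isStep2_iff (herm_step2 (herm_step2 hc _ _ _) _ _ _) ha.third
  constructor
  · rintro ⟨f₁, f₂, hf1, hf2, hg⟩
    rw [h1] at hf1
    rw [hf1, h2] at hf2
    rwa [hf2, h3] at hg
  · rintro rfl
    exact ⟨_, _, (h1 _).2 rfl, (h2 _).2 rfl, (h3 _).2 rfl⟩

/-- The upper bound is (4/3)³ = 64/27 ≥ 2. The two bounds place x₁ in [1, 3/2], which decides the
signs of all exponents below. -/
lemma cbrt_two_bounds : 1 < (2 : ℝ) ^ ((1 : ℝ) / 3) ∧ (2 : ℝ) ^ ((1 : ℝ) / 3) ≤ 4 / 3 := by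
  constructor
  · exact Real.one_lt_rpow one_lt_two (by norm_num)
  · have h : ((4 / 3 : ℝ) ^ (3 : ℕ)) ^ ((1 : ℝ) / 3) = 4 / 3 := by
      rw [← Real.rpow_natCast, ← Real.rpow_mul (by norm_num)]; norm_num
    rw [← h]
    exact Real.rpow_le_rpow (by norm_num) (by norm_num) (by norm_num)

lemma one_le_x₁ : 1 ≤ x₁ := by
  obtain ⟨h1, h2⟩ := cbrt_two_bounds
  rw [x₁, le_div_iff₀ (by linarith)]; linarith

lemma x₁_le : x₁ ≤ 3 / 2 := by
  obtain ⟨h1, h2⟩ := cbrt_two_bounds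
  rw [x₁, div_le_iff₀ (by linarith)]; linarith

/-- The substeps add up to the time τ. Besides 1 ≤ x₁ ≤ 3/2, this is all that stability uses of the
coefficients; the order condition x₀³ = 2x₁³ plays no role. -/
lemma x₀_eq : x₀ = 2 * x₁ - 1 := by
  obtain ⟨h1, h2⟩ := cbrt_two_bounds
  have : (2 - (2 : ℝ) ^ ((1 : ℝ) / 3)) ≠ 0 := by linarith
  rw [x₀, x₁]; field_simp; ring

/-- The factor `exp (-θ z)`, at `z = ν τ k²` the multiplier of the heat flow over a time `θ τ`. -/
def fac (θ z : ℝ) : ℝ := Real.exp (-(θ * z))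

lemma mult_apply (ν τ θ : ℝ) {s : ℝ} (hs : s = θ * τ) (c : ℤ → ℂ) (k : ℤ) :
    mult ν s c k = (fac θ (ν * τ * (k : ℝ) ^ 2) : ℂ) * c k := by
  rw [mult, fac, hs]; congr 4; ring

lemma fac_mul (θ θ' z : ℝ) : fac θ z * fac θ' z = fac (θ + θ') z := by
  rw [fac, fac, fac, ← Real.exp_add]; congr 1; ring

lemma fac_mul_ofReal (θ θ' z : ℝ) (w : ℂ) :
    (fac θ z : ℂ) * ((fac θ' z : ℂ) * w) = (fac (θ + θ') z : ℂ) * w := by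
  rw [← fac_mul]; push_cast; ring

lemma stage1_apply (ν τ : ℝ) (c : ℤ → ℂ) (k : ℤ) :
    stage1 ν τ c k = (fac (x₁ / 2) (ν * τ * (k : ℝ) ^ 2) : ℂ) * c k :=
  mult_apply _ _ _ (by ring) _ _

lemma step2_apply (ν : ℝ) (M : ℕ) (τ θ t : ℝ) (ht : t / 2 = θ * τ) (c : ℤ → ℂ) (k : ℤ) :
    step2 ν M t c k = (fac θ (ν * τ * (k : ℝ) ^ 2) : ℂ) *
      (mult ν (t / 2) c k + incrCoeff M t (mult ν (t / 2) c) k) :=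
  mult_apply ν τ θ ht _ k

/-- The old value collects x₁/2 + x₁/2 − x₀/2 = 1/2, but the first increment only x₁/2 − x₀/2 = (1 −
x₁)/2 ≤ 0: inside the step the backward heat flow does act on increments. -/
lemma stage2_apply (ν : ℝ) (M : ℕ) (τ : ℝ) (c : ℤ → ℂ) (k : ℤ) :
    stage2 ν M τ c k = (fac (1 / 2) (ν * τ * (k : ℝ) ^ 2) : ℂ) * c k +
      (fac ((1 - x₁) / 2) (ν * τ * (k : ℝ) ^ 2) : ℂ) * inc1 ν M τ c k := by
  rw [stage2, mult_apply ν τ (-x₀ / 2) (by ring), step2_apply ν M τ (x₁ / 2) _ (by ring), inc1]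
  change _ * (_ * (stage1 ν τ c k + _)) = _
  rw [stage1_apply, mul_add, mul_add, fac_mul_ofReal, fac_mul_ofReal, fac_mul_ofReal, x₀_eq]
  congr 3
  · congr 1; ring
  · congr 1; ring

lemma stage3_apply (ν : ℝ) (M : ℕ) (τ : ℝ) (c : ℤ → ℂ) (k : ℤ) :
    stage3 ν M τ c k = (fac ((1 - x₁) / 2) (ν * τ * (k : ℝ) ^ 2) : ℂ) *
      (stage2 ν M τ c k + inc2 ν M τ c k) := by
  rw [stage3, mult_apply ν τ (x₁ / 2) (by ring), step2_apply ν M τ (-x₀ / 2) _ (by ring), inc2]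
  change _ * (_ * (stage2 ν M τ c k + incrCoeff M (-x₀ * τ) (stage2 ν M τ c) k)) = _
  rw [fac_mul_ofReal, x₀_eq]
  congr 3; ring

lemma stage3_apply' (ν : ℝ) (M : ℕ) (τ : ℝ) (c : ℤ → ℂ) (k : ℤ) :
    stage3 ν M τ c k = (fac (1 - x₁ / 2) (ν * τ * (k : ℝ) ^ 2) : ℂ) * c k +
      ((fac (1 - x₁) (ν * τ * (k : ℝ) ^ 2) : ℂ) * inc1 ν M τ c k +
      (fac ((1 - x₁) / 2) (ν * τ * (k : ℝ) ^ 2) : ℂ) * inc2 ν M τ c k) := by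
  rw [stage3_apply, stage2_apply, mul_add, mul_add, fac_mul_ofReal, fac_mul_ofReal, add_assoc]
  congr 3
  · congr 1; ring
  · congr 2; ring

/-- After the last half step every exponent lies in [0, 1], so a completed step contains no
amplifying multiplier. -/
lemma step4_apply (ν : ℝ) (M : ℕ) (τ : ℝ) (c : ℤ → ℂ) (k : ℤ) :
    step4 ν M τ c k = (fac 1 (ν * τ * (k : ℝ) ^ 2) : ℂ) * c k +
      ((fac (1 - x₁ / 2) (ν * τ * (k : ℝ) ^ 2) : ℂ) * inc1 ν M τ c k +
      (fac (1 / 2) (ν * τ * (k : ℝ) ^ 2) : ℂ) * inc2 ν M τ c k +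
      (fac (x₁ / 2) (ν * τ * (k : ℝ) ^ 2) : ℂ) * inc3 ν M τ c k) := by
  rw [step4, step2_apply ν M τ (x₁ / 2) _ (by ring), inc3]
  change _ * (stage3 ν M τ c k + incrCoeff M (x₁ * τ) (stage3 ν M τ c) k) = _
  rw [stage3_apply', mul_add, mul_add, mul_add, fac_mul_ofReal, fac_mul_ofReal, fac_mul_ofReal,
    show x₁ / 2 + (1 - x₁ / 2) = 1 by ring, show x₁ / 2 + (1 - x₁) = 1 - x₁ / 2 by ring,
    show x₁ / 2 + (1 - x₁) / 2 = 1 / 2 by ring]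
  ring

lemma fac_le_one {θ z : ℝ} (hθ : 0 ≤ θ) (hz : 0 ≤ z) : fac θ z ≤ 1 :=
  Real.exp_le_one_iff.2 (by nlinarith)

lemma fac_pos (θ z : ℝ) : 0 < fac θ z := Real.exp_pos _

lemma abs_fac_sub_one_le {θ z : ℝ} (hθ : 0 ≤ θ) (hz : 0 ≤ z) : |fac θ z - 1| ≤ θ * z := by
  rw [abs_sub_comm, abs_of_nonneg (by linarith [fac_le_one hθ hz]), fac]
  linarith [Real.add_one_le_exp (-(θ * z))]

/-- The range θ ≥ −1 covers the backward exponents 1 − x₁ and (1 − x₁)/2. -/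
lemma fac_le {θ z Z : ℝ} (hθ : -1 ≤ θ) (hz : 0 ≤ z) (hzZ : z ≤ Z) : fac θ z ≤ Real.exp Z :=
  Real.exp_le_exp.2 (by nlinarith)

/-- From 1 − e^{−2z} ≥ 2z e^{−2z} and z ≤ Z. The CFL bound thus also makes the damping comparable to
z at every retained frequency. Of the 2z gained, later estimates spend one half on Young's
inequality and keep the other. -/
lemma fac_one_sq_le {z Z : ℝ} (hz : 0 ≤ z) (hzZ : z ≤ Z) :
    fac 1 z ^ 2 ≤ 1 - 2 * Real.exp (-(2 * Z)) * z := by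
  have h1 : fac 1 z ^ 2 = Real.exp (-(2 * z)) := by
    rw [fac, ← Real.exp_nat_mul]; congr 1; push_cast; ring
  have h2 := Real.add_one_le_exp (2 * z)
  have h3 : Real.exp (-(2 * Z)) ≤ Real.exp (-(2 * z)) := Real.exp_le_exp.2 (by linarith)
  have h4 : Real.exp (-(2 * z)) * Real.exp (2 * z) = 1 := by rw [← Real.exp_add]; simp
  rw [h1]
  nlinarith [Real.exp_pos (-(2 * z)), mul_le_mul_of_nonneg_left h2 (Real.exp_pos (-(2 * z))).le]

lemma heat_arg_bounds {ν l τ : ℝ} {M : ℕ} {k : ℤ} (hν : 0 < ν) (hτ : 0 < τ)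
    (hM : τ * (M : ℝ) ^ 2 ≤ l) (hk : k ∈ Finset.Icc (-(M : ℤ)) M) :
    0 ≤ ν * τ * (k : ℝ) ^ 2 ∧ ν * τ * (k : ℝ) ^ 2 ≤ ν * l ∧ (k : ℝ) ^ 2 ≤ (M : ℝ) ^ 2 := by
  have hk' : (k : ℝ) ^ 2 ≤ (M : ℝ) ^ 2 := by
    rw [Finset.mem_Icc] at hk
    exact sq_le_sq' (by exact_mod_cast hk.1) (by exact_mod_cast hk.2)
  refine ⟨by positivity, ?_, hk'⟩
  rw [mul_assoc]
  exact mul_le_mul_of_nonneg_left ((mul_le_mul_of_nonneg_left hk' hτ.le).trans hM) hν.le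

end

/-! ### Stage bounds and propagation of higher regularity -/

section

open Set

lemma hNorm_le_of_norm_le {M s : ℕ} {c d : ℤ → ℂ} {κ : ℝ}
    (h : ∀ k ∈ Finset.Icc (-(M : ℤ)) M, ‖d k‖ ≤ κ * ‖c k‖) : hNorm M s d ≤ κ ^ 2 * hNorm M s c := by
  unfold hNorm
  rw [Finset.mul_sum]
  refine Finset.sum_le_sum fun k hk => ?_
  have := pow_le_pow_left₀ (norm_nonneg _) (h k hk) 2
  rw [mul_pow] at this
  nlinarith [mul_le_mul_of_nonneg_left this (even_pow_nonneg (k : ℝ) s)]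

/-- The squared Sobolev norm of order `max s 1`, up to constants. -/
def wNorm (M s : ℕ) (c : ℤ → ℂ) : ℝ := yNorm M c + hNorm M s c

lemma wNorm_le_of_norm_le {M s : ℕ} {c d : ℤ → ℂ} {κ : ℝ}
    (h : ∀ k ∈ Finset.Icc (-(M : ℤ)) M, ‖d k‖ ≤ κ * ‖c k‖) : wNorm M s d ≤ κ ^ 2 * wNorm M s c := by
  unfold wNorm yNorm
  linarith [hNorm_le_of_norm_le (s := 0) h, hNorm_le_of_norm_le (s := 1) h,
    hNorm_le_of_norm_le (s := s) h]

lemma wNorm_add_le (M s : ℕ) (c d : ℤ → ℂ) :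
    wNorm M s (fun k => c k + d k) ≤ 2 * wNorm M s c + 2 * wNorm M s d := by
  unfold wNorm; linarith [yNorm_add_le M c d, hNorm_add_le M s c d]

lemma yNorm_le_wNorm (M s : ℕ) (c : ℤ → ℂ) : yNorm M c ≤ wNorm M s c :=
  le_add_of_nonneg_right (hNorm_nonneg _ _ _)

lemma hNorm_le_wNorm (M s : ℕ) (c : ℤ → ℂ) : hNorm M s c ≤ wNorm M s c :=
  le_add_of_nonneg_left (yNorm_nonneg _ _)

lemma exists_wNorm_incr_le (s : ℕ) (B : ℝ) : ∃ C, 0 ≤ C ∧ ∀ (M : ℕ) (c : ℤ → ℂ) (t : ℝ),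
    Herm c → |t| ≤ 1 → Admissible t (truncSum M c) → wNorm M s c ≤ B →
      wNorm M s (incrCoeff M t c) ≤ C * t ^ 2 := by
  obtain ⟨C0, h0, hC0⟩ := exists_yNorm_incr_le B
  obtain ⟨C1, h1, hC1⟩ := exists_hNorm_incr_le s B
  refine ⟨C0 + C1, by positivity, fun M c t hc ht ha hw => ?_⟩
  have e0 := hC0 M c t hc ht ha ((yNorm_le_wNorm _ _ _).trans hw)
  have e1 := hC1 M c t hc ht ha ((yNorm_le_wNorm _ _ _).trans hw) ((hNorm_le_wNorm _ _ _).trans hw)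
  unfold wNorm incrCoeff
  linarith

lemma norm_fac_mul (θ z : ℝ) (w : ℂ) : ‖(fac θ z : ℂ) * w‖ = fac θ z * ‖w‖ := by
  rw [norm_mul, Complex.norm_real, Real.norm_of_nonneg (fac_pos _ _).le]

/-- The standing assumptions on the parameters. -/
structure Params (ν l : ℝ) (M : ℕ) (τ : ℝ) : Prop where
  ν_pos : 0 < ν
  l_pos : 0 < l
  τ_pos : 0 < τ
  τ_le : τ ≤ 1 / 2
  cfl : τ * (M : ℝ) ^ 2 ≤ l

namespace Params

variable {ν l τ : ℝ} {M : ℕ} (h : Params ν l M τ)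
include h

lemma abs_x₁_mul_le : |x₁ * τ| ≤ 1 := by
  have := one_le_x₁; have := x₁_le; have := h.τ_pos; have := h.τ_le
  rw [abs_of_nonneg (by positivity)]; nlinarith

lemma abs_x₀_mul_le : |-x₀ * τ| ≤ 1 := by
  have := one_le_x₁; have := x₁_le; have := h.τ_pos; have := h.τ_le
  rw [x₀_eq, abs_le]; constructor <;> nlinarith

end Params

lemma x₁_mul_sq_le (τ : ℝ) : (x₁ * τ) ^ 2 ≤ 4 * τ ^ 2 := by
  have := one_le_x₁; have := x₁_le
  rw [mul_pow]; gcongr; nlinarith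

lemma x₀_mul_sq_le (τ : ℝ) : (-x₀ * τ) ^ 2 ≤ 4 * τ ^ 2 := by
  have := one_le_x₁; have := x₁_le
  rw [x₀_eq, mul_pow]; gcongr; nlinarith

lemma herm_stage1 {c : ℤ → ℂ} (hc : Herm c) (ν τ : ℝ) : Herm (stage1 ν τ c) := hc.mult _ _

lemma herm_stage2 {c : ℤ → ℂ} (hc : Herm c) (ν : ℝ) (M : ℕ) (τ : ℝ) : Herm (stage2 ν M τ c) :=
  (herm_step2 hc _ _ _).mult _ _

lemma herm_stage3 {c : ℤ → ℂ} (hc : Herm c) (ν : ℝ) (M : ℕ) (τ : ℝ) : Herm (stage3 ν M τ c) :=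
  (herm_step2 (herm_step2 hc _ _ _) _ _ _).mult _ _

/-- Bounds for the stages and increments. -/
lemma exists_stage_bounds (ν l : ℝ) (s : ℕ) {B : ℝ} (hB : 0 ≤ B) : ∃ C, 0 ≤ C ∧
    ∀ (M : ℕ) (τ : ℝ) (c : ℤ → ℂ), Params ν l M τ → Herm c → wNorm M s c ≤ B →
      wNorm M s (stage1 ν τ c) ≤ C ∧
      (Admissible (x₁ * τ) (truncSum M (stage1 ν τ c)) →
        wNorm M s (inc1 ν M τ c) ≤ C * τ ^ 2 ∧ wNorm M s (stage2 ν M τ c) ≤ C ∧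
        (Admissible (-x₀ * τ) (truncSum M (stage2 ν M τ c)) →
          wNorm M s (inc2 ν M τ c) ≤ C * τ ^ 2 ∧ wNorm M s (stage3 ν M τ c) ≤ C ∧
          (Admissible (x₁ * τ) (truncSum M (stage3 ν M τ c)) →
            wNorm M s (inc3 ν M τ c) ≤ C * τ ^ 2))) := by
  -- Bounds the backward multipliers uniformly in M. The admissibility hypotheses in the conclusion
  -- are nested because that of each stage is later deduced from the bound on this stage.
  set κ := Real.exp (ν * l)
  obtain ⟨C1, hC1, h1⟩ := exists_wNorm_incr_le s B
  set B2 := 2 * B + 2 * (κ ^ 2 * C1)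
  obtain ⟨C2, hC2, h2⟩ := exists_wNorm_incr_le s B2
  set B3 := κ ^ 2 * (2 * B2 + 2 * C2)
  obtain ⟨C3, hC3, h3⟩ := exists_wNorm_incr_le s B3
  have hB2 : 0 ≤ B2 := by positivity
  have hB3 : 0 ≤ B3 := by positivity
  refine ⟨B + B2 + B3 + 4 * C1 + 4 * C2 + 4 * C3, by positivity, ?_⟩
  intro M τ c hp hc hw
  have hx1 := one_le_x₁
  have hx2 := x₁_le
  have hz := fun k (hk : k ∈ Finset.Icc (-(M : ℤ)) M) =>
    heat_arg_bounds hp.ν_pos hp.τ_pos hp.cfl hk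
  have hτ2 : 4 * τ ^ 2 ≤ 1 := by nlinarith [hp.τ_pos, hp.τ_le]
  have hτ0 : 0 ≤ τ ^ 2 := sq_nonneg τ
  have w1 : wNorm M s (stage1 ν τ c) ≤ B := by
    refine (wNorm_le_of_norm_le (κ := 1) (c := c) fun k hk => ?_).trans (by simpa using hw)
    rw [stage1_apply, norm_fac_mul]
    exact mul_le_mul_of_nonneg_right (fac_le_one (by linarith) (hz k hk).1) (norm_nonneg _)
  refine ⟨w1.trans (by linarith), fun a1 => ?_⟩
  have g1 : wNorm M s (inc1 ν M τ c) ≤ C1 * (4 * τ ^ 2) :=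
    (h1 M _ _ (herm_stage1 hc _ _) hp.abs_x₁_mul_le a1 w1).trans
      (mul_le_mul_of_nonneg_left (x₁_mul_sq_le τ) hC1)
  have w2 : wNorm M s (stage2 ν M τ c) ≤ B2 := by
    rw [funext (stage2_apply ν M τ c)]
    refine (wNorm_add_le _ _ _ _).trans ?_
    have e1 := wNorm_le_of_norm_le (M := M) (s := s) (κ := 1) (c := c)
      (d := fun k => (fac (1 / 2) (ν * τ * (k : ℝ) ^ 2) : ℂ) * c k) fun k hk => by
        rw [norm_fac_mul]
        exact mul_le_mul_of_nonneg_right (fac_le_one (by norm_num) (hz k hk).1) (norm_nonneg _)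
    have e2 := wNorm_le_of_norm_le (M := M) (s := s) (κ := κ) (c := inc1 ν M τ c)
      (d := fun k => (fac ((1 - x₁) / 2) (ν * τ * (k : ℝ) ^ 2) : ℂ) * inc1 ν M τ c k) fun k hk => by
        rw [norm_fac_mul]
        exact mul_le_mul_of_nonneg_right (fac_le (by linarith) (hz k hk).1 (hz k hk).2.1)
          (norm_nonneg _)
    have e3 : κ ^ 2 * wNorm M s (inc1 ν M τ c) ≤ κ ^ 2 * C1 := by
      gcongr; exact g1.trans (mul_le_of_le_one_right hC1 hτ2)
    linarith
  refine ⟨g1.trans (by nlinarith), w2.trans (by linarith), fun a2 => ?_⟩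
  have g2 : wNorm M s (inc2 ν M τ c) ≤ C2 * (4 * τ ^ 2) :=
    (h2 M _ _ (herm_stage2 hc _ _ _) hp.abs_x₀_mul_le a2 w2).trans
      (mul_le_mul_of_nonneg_left (x₀_mul_sq_le τ) hC2)
  have w3 : wNorm M s (stage3 ν M τ c) ≤ B3 := by
    rw [funext (stage3_apply ν M τ c)]
    refine (wNorm_le_of_norm_le (κ := κ) (c := fun k => stage2 ν M τ c k + inc2 ν M τ c k)
      fun k hk => ?_).trans ?_
    · rw [norm_fac_mul]
      exact mul_le_mul_of_nonneg_right (fac_le (by linarith) (hz k hk).1 (hz k hk).2.1)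
        (norm_nonneg _)
    · refine mul_le_mul_of_nonneg_left ((wNorm_add_le _ _ _ _).trans ?_) (by positivity)
      have := g2.trans (mul_le_of_le_one_right hC2 hτ2)
      linarith
  refine ⟨g2.trans (by nlinarith), w3.trans (by linarith), fun a3 => ?_⟩
  refine ((h3 M _ _ (herm_stage3 hc _ _ _) hp.abs_x₁_mul_le a3 w3).trans
    (mul_le_mul_of_nonneg_left (x₁_mul_sq_le τ) hC3)).trans (by nlinarith)

/-- Boundedness in `H¹` and a small time step make the step admissible. -/
lemma admissible_of_yNorm_le {M : ℕ} {c : ℤ → ℂ} {C t : ℝ} (h : yNorm M c ≤ C)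
    (ht : |t| * (embConst * C) ≤ 1 / 8) : Admissible t (truncSum M c) := fun x =>
  (mul_le_mul_of_nonneg_left ((truncSum_sq_le M c x).trans
    (mul_le_mul_of_nonneg_left h embConst_pos.le)) (abs_nonneg t)).trans ht

/-- The increments of an admissible step have size `τ`. -/
lemma exists_inc_bounds (ν l : ℝ) (s : ℕ) {B : ℝ} (hB : 0 ≤ B) : ∃ C, 0 ≤ C ∧
    ∀ (M : ℕ) (τ : ℝ) (c : ℤ → ℂ), Params ν l M τ → Herm c → wNorm M s c ≤ B →
      StepAdmissible ν M τ c → wNorm M s (inc1 ν M τ c) ≤ C * τ ^ 2 ∧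
        wNorm M s (inc2 ν M τ c) ≤ C * τ ^ 2 ∧ wNorm M s (inc3 ν M τ c) ≤ C * τ ^ 2 := by
  obtain ⟨C, hC, h⟩ := exists_stage_bounds ν l s hB
  refine ⟨C, hC, fun M τ c hp hc hw ha => ?_⟩
  obtain ⟨-, h1⟩ := h M τ c hp hc hw
  obtain ⟨g1, -, h2⟩ := h1 ha.first
  obtain ⟨g2, -, h3⟩ := h2 ha.second
  exact ⟨g1, g2, h3 ha.third⟩

lemma two_mul_norm_le_of_pos {a b w : ℝ} (hw : 0 < w) : 2 * a * b ≤ w * a ^ 2 + b ^ 2 / w := by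
  have : 0 ≤ (w * a - b) ^ 2 / w := by positivity
  have e : (w * a - b) ^ 2 / w = w * a ^ 2 - 2 * a * b + b ^ 2 / w := by field_simp; ring
  linarith

/-- The gain of one derivative over one step. -/
lemma hNorm_step4_le {ν l τ : ℝ} {M : ℕ} (hp : Params ν l M τ) (s : ℕ) (c : ℤ → ℂ) {G : ℝ}
    (h1 : hNorm M s (inc1 ν M τ c) ≤ G) (h2 : hNorm M s (inc2 ν M τ c) ≤ G)
    (h3 : hNorm M s (inc3 ν M τ c) ≤ G) :
    hNorm M (s + 1) (step4 ν M τ c) ≤ hNorm M (s + 1) c -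
      Real.exp (-(2 * (ν * l))) * (ν * τ) * hNorm M (s + 2) c +
      9 * (1 / (Real.exp (-(2 * (ν * l))) * (ν * τ)) + (M : ℝ) ^ 2) * G := by
  set η := Real.exp (-(2 * (ν * l)))
  have hη : 0 < η := Real.exp_pos _
  have hντ : 0 < ν * τ := mul_pos hp.ν_pos hp.τ_pos
  have hx1 := one_le_x₁
  have hx2 := x₁_le
  have key : ∀ k ∈ Finset.Icc (-(M : ℤ)) M,
      (k : ℝ) ^ (2 * (s + 1)) * ‖step4 ν M τ c k‖ ^ 2 ≤
      (k : ℝ) ^ (2 * (s + 1)) * ‖c k‖ ^ 2 - η * (ν * τ) * ((k : ℝ) ^ (2 * (s + 2)) * ‖c k‖ ^ 2) +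
      3 * (1 / (η * (ν * τ)) + (M : ℝ) ^ 2) * ((k : ℝ) ^ (2 * s) * ‖inc1 ν M τ c k‖ ^ 2 +
        (k : ℝ) ^ (2 * s) * ‖inc2 ν M τ c k‖ ^ 2 + (k : ℝ) ^ (2 * s) * ‖inc3 ν M τ c k‖ ^ 2) := by
    intro k hk
    obtain ⟨hz0, hzZ, hkM⟩ := heat_arg_bounds hp.ν_pos hp.τ_pos hp.cfl hk
    have hw0 : 0 ≤ (k : ℝ) ^ (2 * s) := even_pow_nonneg _ _
    -- The mean has weight zero at order s + 1; it is set aside because z = 0 would be a divisor.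
    rcases eq_or_ne k 0 with rfl | hk0
    · have e1 : ((0 : ℤ) : ℝ) ^ (2 * (s + 1)) = 0 := by simp
      have e2 : ((0 : ℤ) : ℝ) ^ (2 * (s + 2)) = 0 := by simp
      rw [e1, e2]
      have : 0 ≤ 3 * (1 / (η * (ν * τ)) + (M : ℝ) ^ 2) * (((0 : ℤ) : ℝ) ^ (2 * s) *
        ‖inc1 ν M τ c 0‖ ^ 2 + ((0 : ℤ) : ℝ) ^ (2 * s) * ‖inc2 ν M τ c 0‖ ^ 2 +
        ((0 : ℤ) : ℝ) ^ (2 * s) * ‖inc3 ν M τ c 0‖ ^ 2) := by positivity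
      linarith
    have hk2 : 0 < (k : ℝ) ^ 2 := by
      have : (k : ℝ) ≠ 0 := by exact_mod_cast hk0
      positivity
    set z := ν * τ * (k : ℝ) ^ 2
    have hz : 0 < z := by positivity
    set γ := ‖inc1 ν M τ c k‖ + ‖inc2 ν M τ c k‖ + ‖inc3 ν M τ c k‖
    have hγ0 : 0 ≤ γ := by positivity
    have n1 : ‖step4 ν M τ c k‖ ≤ fac 1 z * ‖c k‖ + γ := by
      rw [step4_apply]
      refine (norm_add_le _ _).trans (add_le_add (norm_fac_mul _ _ _).le
        ((norm_add₃_le).trans (add_le_add (add_le_add ?_ ?_) ?_)))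
      all_goals
        rw [norm_fac_mul]
        exact mul_le_of_le_one_left (norm_nonneg _) (fac_le_one (by linarith) hz0)
    have n2 : ‖step4 ν M τ c k‖ ^ 2 ≤ ‖c k‖ ^ 2 - η * z * ‖c k‖ ^ 2 + γ ^ 2 / (η * z) + γ ^ 2 := by
      have a1 := pow_le_pow_left₀ (norm_nonneg _) n1 2
      have a2 := mul_le_mul_of_nonneg_right (fac_one_sq_le hz0 hzZ) (sq_nonneg ‖c k‖)
      have a3 := two_mul_norm_le_of_pos (a := ‖c k‖) (b := γ) (mul_pos hη hz)
      have a4 : fac 1 z * (‖c k‖ * γ) ≤ ‖c k‖ * γ :=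
        mul_le_of_le_one_left (by positivity) (fac_le_one zero_le_one hz0)
      nlinarith
    have n3 : γ ^ 2 ≤ 3 * (‖inc1 ν M τ c k‖ ^ 2 + ‖inc2 ν M τ c k‖ ^ 2 + ‖inc3 ν M τ c k‖ ^ 2) := by
      nlinarith [sq_nonneg (‖inc1 ν M τ c k‖ - ‖inc2 ν M τ c k‖),
        sq_nonneg (‖inc1 ν M τ c k‖ - ‖inc3 ν M τ c k‖),
        sq_nonneg (‖inc2 ν M τ c k‖ - ‖inc3 ν M τ c k‖)]
    have e1 : (k : ℝ) ^ (2 * (s + 1)) = (k : ℝ) ^ (2 * s) * (k : ℝ) ^ 2 := by ring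
    have e2 : (k : ℝ) ^ (2 * (s + 2)) = (k : ℝ) ^ (2 * s) * (k : ℝ) ^ 2 * (k : ℝ) ^ 2 := by ring
    -- Division by z = ντk² lowers the weight on the increments from order s + 1 to order s; this is
    -- the gained derivative.
    have e3 : (k : ℝ) ^ (2 * (s + 1)) * (γ ^ 2 / (η * z)) =
        (k : ℝ) ^ (2 * s) * (1 / (η * (ν * τ)) * γ ^ 2) := by
      rw [e1]
      have : z = ν * τ * (k : ℝ) ^ 2 := rfl
      rw [this]
      have := hk2.ne'
      field_simp
    calc (k : ℝ) ^ (2 * (s + 1)) * ‖step4 ν M τ c k‖ ^ 2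
        ≤ (k : ℝ) ^ (2 * (s + 1)) *
          (‖c k‖ ^ 2 - η * z * ‖c k‖ ^ 2 + γ ^ 2 / (η * z) + γ ^ 2) :=
          mul_le_mul_of_nonneg_left n2 (even_pow_nonneg _ _)
      _ = (k : ℝ) ^ (2 * (s + 1)) * ‖c k‖ ^ 2 -
          η * (ν * τ) * ((k : ℝ) ^ (2 * (s + 2)) * ‖c k‖ ^ 2) +
          (k : ℝ) ^ (2 * s) * ((1 / (η * (ν * τ)) + (k : ℝ) ^ 2) * γ ^ 2) := by
          rw [mul_add, mul_add, e3, e1, e2]; simp only [z]; ring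
      _ ≤ (k : ℝ) ^ (2 * (s + 1)) * ‖c k‖ ^ 2 -
          η * (ν * τ) * ((k : ℝ) ^ (2 * (s + 2)) * ‖c k‖ ^ 2) +
          (k : ℝ) ^ (2 * s) * ((1 / (η * (ν * τ)) + (M : ℝ) ^ 2) *
            (3 * (‖inc1 ν M τ c k‖ ^ 2 + ‖inc2 ν M τ c k‖ ^ 2 + ‖inc3 ν M τ c k‖ ^ 2))) := by
          gcongr
      _ = _ := by ring
  have hsum := Finset.sum_le_sum key
  simp only [Finset.sum_add_distrib, Finset.sum_sub_distrib, ← Finset.mul_sum] at hsum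
  change hNorm M (s + 1) (step4 ν M τ c) ≤ hNorm M (s + 1) c - η * (ν * τ) * hNorm M (s + 2) c +
    3 * (1 / (η * (ν * τ)) + (M : ℝ) ^ 2) * (hNorm M s (inc1 ν M τ c) + hNorm M s (inc2 ν M τ c) +
      hNorm M s (inc3 ν M τ c)) at hsum
  have hK : 0 ≤ 1 / (η * (ν * τ)) + (M : ℝ) ^ 2 := by positivity
  nlinarith [mul_le_mul_of_nonneg_left (add_le_add (add_le_add h1 h2) h3) hK]

/-- Propagation of bounds of one order to the next, for iterates bounded in `H¹`. -/
lemma exists_hNorm_succ_bound {ν l : ℝ} (hν : 0 < ν) (hl : 0 < l) {s : ℕ} (hs : 1 ≤ s) {B : ℝ}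
    (hB : 0 ≤ B) : ∃ A, 0 ≤ A ∧ ∀ (M : ℕ) (τ : ℝ) (c : ℕ → ℤ → ℂ), Params ν l M τ →
      (∀ n, Herm (c n)) → (∀ n, StepAdmissible ν M τ (c n)) →
      (∀ n, c (n + 1) = step4 ν M τ (c n)) → (∀ n, wNorm M s (c n) ≤ B) →
      hNorm M (s + 1) (c 0) ≤ B → ∀ n, hNorm M (s + 1) (c n) ≤ A := by
  obtain ⟨C, hC, h⟩ := exists_inc_bounds ν l s hB
  set η := Real.exp (-(2 * (ν * l)))
  have hη : 0 < η := Real.exp_pos _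
  -- Production per step is at most Eτ: squared increments Cτ² meet the factor 1/(ηντ), and τM² ≤ l
  -- handles the other term.
  set E := 9 * (1 / (η * ν) + l) * C
  have hE : 0 ≤ E := by positivity
  refine ⟨B + E / (η * ν) + E, by positivity, ?_⟩
  intro M τ c hp hc ha hstep hw h0 n
  induction n with
  | zero => exact h0.trans (by have : 0 ≤ E / (η * ν) := by positivity
                               linarith)
  | succ n ih =>
    obtain ⟨g1, g2, g3⟩ := h M τ (c n) hp (hc n) (hw n) (ha n)
    have hτ := hp.τ_pos
    have main := hNorm_step4_le hp s (c n) ((hNorm_le_wNorm _ _ _).trans g1)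
      ((hNorm_le_wNorm _ _ _).trans g2) ((hNorm_le_wNorm _ _ _).trans g3)
    rw [← hstep] at main
    have e1 : 9 * (1 / (η * (ν * τ)) + (M : ℝ) ^ 2) * (C * τ ^ 2) ≤ E * τ := by
      have : 9 * (1 / (η * (ν * τ)) + (M : ℝ) ^ 2) * (C * τ ^ 2) =
          9 * (1 / (η * ν) + τ * (M : ℝ) ^ 2) * C * τ := by field_simp
      rw [this]
      refine mul_le_mul_of_nonneg_right ?_ hτ.le
      change _ ≤ 9 * (1 / (η * ν) + l) * C
      gcongr
      exact hp.cfl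
    -- A Poincaré inequality: nonzero integer frequencies satisfy |k| ≥ 1.
    have e2 : hNorm M (s + 1) (c n) ≤ hNorm M (s + 2) (c n) :=
      hNorm_mono_order M (by omega) (by omega) _
    have e3 : η * (ν * τ) * hNorm M (s + 1) (c n) ≤ η * (ν * τ) * hNorm M (s + 2) (c n) :=
      mul_le_mul_of_nonneg_left e2 (by positivity)
    have main' : hNorm M (s + 1) (c (n + 1)) ≤ hNorm M (s + 1) (c n) -
        (η * ν * hNorm M (s + 1) (c n) - E) * τ := by
      have : η * (ν * τ) * hNorm M (s + 1) (c n) = η * ν * hNorm M (s + 1) (c n) * τ := by ring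
      linarith
    -- Above the level E/(ην) the norm does not increase; below it, one step adds at most Eτ ≤ E.
    rcases le_total E (η * ν * hNorm M (s + 1) (c n)) with hcase | hcase
    · exact main'.trans (by nlinarith)
    · have b1 : hNorm M (s + 1) (c n) ≤ E / (η * ν) := by
        rw [le_div_iff₀ (by positivity)]; linarith
      have b2 : 0 ≤ η * ν * hNorm M (s + 1) (c n) * τ := by
        have := hNorm_nonneg M (s + 1) (c n); positivity
      have b3 : E * τ ≤ E := mul_le_of_le_one_right hE (hp.τ_le.trans (by norm_num))
      linarith

end

/-! ### The energy estimate in H¹ -/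

section

open Set

/-- The energy identity for one frequency, up to errors controlled by the deviations of the
increments from their first-order expansions. -/
lemma norm_sq_step_le {η z τ w a₁ a₂ a₃ θ₁ θ₂ θ₃ : ℝ} (hη : 0 < η) (hz : 0 ≤ z) (hτ : 0 < τ)
    (hw : 0 < w) (hfac : fac 1 z ^ 2 ≤ 1 - 2 * η * z) (ha₁ : a₁ ∈ Icc (0 : ℝ) 1)
    (ha₂ : a₂ ∈ Icc (0 : ℝ) 1) (ha₃ : a₃ ∈ Icc (0 : ℝ) 1) (hθ₁ : |θ₁| ≤ 2) (hθ₂ : |θ₂| ≤ 2)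
    (hθ₃ : |θ₃| ≤ 2) (hθ : θ₁ + θ₂ + θ₃ = 1) (c h g₁ g₂ g₃ : ℂ) :
    ‖(fac 1 z : ℂ) * c + ((fac a₁ z : ℂ) * g₁ + (fac a₂ z : ℂ) * g₂ + (fac a₃ z : ℂ) * g₃)‖ ^ 2 ≤
      (1 - η * z + w * τ ^ 2) * ‖c‖ ^ 2 + 2 * τ * (starRingEnd ℂ c * h).re +
      3 * (1 / (w * τ ^ 2) + 2) * (‖g₁ - (θ₁ * τ : ℝ) * h‖ ^ 2 + ‖g₂ - (θ₂ * τ : ℝ) * h‖ ^ 2 +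
        ‖g₃ - (θ₃ * τ : ℝ) * h‖ ^ 2) + (144 / η * z + 72) * τ ^ 2 * ‖h‖ ^ 2 := by
  set d₁ := g₁ - (θ₁ * τ : ℝ) * h with hd₁
  set d₂ := g₂ - (θ₂ * τ : ℝ) * h with hd₂
  set d₃ := g₃ - (θ₃ * τ : ℝ) * h with hd₃
  set γ := (fac a₁ z : ℂ) * g₁ + (fac a₂ z : ℂ) * g₂ + (fac a₃ z : ℂ) * g₃ with hγ
  set S := ‖d₁‖ + ‖d₂‖ + ‖d₃‖ with hS
  have hS0 : 0 ≤ S := by positivity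
  have hsmall : ∀ (a : ℝ) (d : ℂ), 0 ≤ a → ‖(fac a z : ℂ) * d‖ ≤ ‖d‖ := fun a d h => by
    rw [norm_fac_mul]; exact mul_le_of_le_one_left (norm_nonneg _) (fac_le_one h hz)
  have hterm : ∀ (θ a : ℝ), |θ| ≤ 2 → a ∈ Icc (0 : ℝ) 1 →
      ‖((θ * (fac (1 + a) z - 1) : ℝ) : ℂ)‖ ≤ 4 * z := fun θ a hθ ha => by
    rw [Complex.norm_real, Real.norm_eq_abs, abs_mul]
    have h1 := abs_fac_sub_one_le (θ := 1 + a) (by linarith [ha.1]) hz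
    have h2 : (1 + a) * z ≤ 2 * z := mul_le_mul_of_nonneg_right (by linarith [ha.2]) hz
    nlinarith [abs_nonneg (fac (1 + a) z - 1), abs_nonneg θ]
  -- In the cross term each increment carries a total exponent 1 + aᵢ ≤ 2. Replacing these factors
  -- by 1 costs |θᵢ|·2z ≤ 4z each, hence 12; what remains of h is τ(θ₁ + θ₂ + θ₃) = τ.
  have hdev : ‖(fac 1 z : ℂ) * γ - (τ : ℂ) * h‖ ≤ S + 12 * τ * z * ‖h‖ := by
    have e : (fac 1 z : ℂ) * γ - (τ : ℂ) * h =
        ((fac (1 + a₁) z : ℂ) * d₁ + (fac (1 + a₂) z : ℂ) * d₂ + (fac (1 + a₃) z : ℂ) * d₃) +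
        (τ : ℂ) * (((θ₁ * (fac (1 + a₁) z - 1) : ℝ) : ℂ) + ((θ₂ * (fac (1 + a₂) z - 1) : ℝ) : ℂ) +
          ((θ₃ * (fac (1 + a₃) z - 1) : ℝ) : ℂ)) * h := by
      rw [hγ, hd₁, hd₂, hd₃, ← fac_mul, ← fac_mul, ← fac_mul]
      have hθc : (θ₁ : ℂ) + θ₂ + θ₃ = 1 := by exact_mod_cast hθ
      push_cast
      linear_combination ((τ : ℂ) * h) * hθc
    rw [e]
    refine (norm_add_le _ _).trans (add_le_add ?_ ?_)
    · refine norm_add₃_le.trans (add_le_add (add_le_add ?_ ?_) ?_)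
      · exact hsmall _ _ (by linarith [ha₁.1])
      · exact hsmall _ _ (by linarith [ha₂.1])
      · exact hsmall _ _ (by linarith [ha₃.1])
    · rw [norm_mul, norm_mul, Complex.norm_real, Real.norm_of_nonneg hτ.le]
      refine mul_le_mul_of_nonneg_right ?_ (norm_nonneg _)
      have := norm_add₃_le.trans (add_le_add (add_le_add (hterm θ₁ a₁ hθ₁ ha₁)
        (hterm θ₂ a₂ hθ₂ ha₂)) (hterm θ₃ a₃ hθ₃ ha₃))
      nlinarith
  have hγn : ‖γ‖ ≤ S + 6 * τ * ‖h‖ := by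
    have hg : ∀ (θ : ℝ) (g d : ℂ), |θ| ≤ 2 → d = g - (θ * τ : ℝ) * h →
        ‖g‖ ≤ ‖d‖ + 2 * τ * ‖h‖ := fun θ g d hθ hd => by
      have : g = d + (θ * τ : ℝ) * h := by rw [hd]; ring
      rw [this]
      refine (norm_add_le _ _).trans (add_le_add le_rfl ?_)
      rw [norm_mul, Complex.norm_real, Real.norm_eq_abs, abs_mul, abs_of_pos hτ]
      gcongr
    have b₁ := hg θ₁ g₁ d₁ hθ₁ hd₁
    have b₂ := hg θ₂ g₂ d₂ hθ₂ hd₂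
    have b₃ := hg θ₃ g₃ d₃ hθ₃ hd₃
    have := norm_add₃_le.trans (add_le_add (add_le_add (hsmall a₁ g₁ ha₁.1)
      (hsmall a₂ g₂ ha₂.1)) (hsmall a₃ g₃ ha₃.1))
    rw [hγ]
    linarith
  have hexp : ‖(fac 1 z : ℂ) * c + γ‖ ^ 2 = fac 1 z ^ 2 * ‖c‖ ^ 2 +
      2 * (starRingEnd ℂ c * ((fac 1 z : ℂ) * γ)).re + ‖γ‖ ^ 2 := by
    simp only [← Complex.normSq_eq_norm_sq, Complex.normSq_apply, Complex.add_re, Complex.add_im,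
      Complex.mul_re, Complex.mul_im, Complex.ofReal_re, Complex.ofReal_im, Complex.conj_re,
      Complex.conj_im]
    ring
  have hcross : (starRingEnd ℂ c * ((fac 1 z : ℂ) * γ)).re ≤ τ * (starRingEnd ℂ c * h).re +
      ‖c‖ * (S + 12 * τ * z * ‖h‖) := by
    have e : starRingEnd ℂ c * ((fac 1 z : ℂ) * γ) = (τ : ℂ) * (starRingEnd ℂ c * h) +
        starRingEnd ℂ c * ((fac 1 z : ℂ) * γ - (τ : ℂ) * h) := by ring
    rw [e, Complex.add_re, Complex.re_ofReal_mul]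
    refine add_le_add le_rfl ((Complex.re_le_norm _).trans ?_)
    rw [norm_mul, RCLike.norm_conj]
    exact mul_le_mul_of_nonneg_left hdev (norm_nonneg _)
  have hwτ : 0 < w * τ ^ 2 := by positivity
  -- The weight wτ² matches deviations with S² of size τ⁴ + τ²·dissipation: the quotient is a
  -- multiple of the dissipation that is small for large w, at the price of wτ²‖c‖².
  have y1 := two_mul_norm_le_of_pos (a := ‖c‖) (b := S) hwτ
  have y2 : 24 * τ * z * (‖c‖ * ‖h‖) ≤ η * z * ‖c‖ ^ 2 + 144 / η * z * τ ^ 2 * ‖h‖ ^ 2 := by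
    have := mul_le_mul_of_nonneg_left (two_mul_norm_le_of_pos (a := ‖c‖) (b := 12 * τ * ‖h‖) hη) hz
    have e : z * (η * ‖c‖ ^ 2 + (12 * τ * ‖h‖) ^ 2 / η) =
        η * z * ‖c‖ ^ 2 + 144 / η * z * τ ^ 2 * ‖h‖ ^ 2 := by field_simp; ring
    rw [e] at this
    linarith
  have y3 : ‖γ‖ ^ 2 ≤ 2 * S ^ 2 + 72 * τ ^ 2 * ‖h‖ ^ 2 := by
    have := pow_le_pow_left₀ (norm_nonneg _) hγn 2
    nlinarith [sq_nonneg (S - 6 * τ * ‖h‖)]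
  have y4 : S ^ 2 ≤ 3 * (‖d₁‖ ^ 2 + ‖d₂‖ ^ 2 + ‖d₃‖ ^ 2) := by
    rw [hS]
    nlinarith [sq_nonneg (‖d₁‖ - ‖d₂‖), sq_nonneg (‖d₁‖ - ‖d₃‖), sq_nonneg (‖d₂‖ - ‖d₃‖)]
  have y5 : (1 / (w * τ ^ 2) + 2) * S ^ 2 ≤
      (1 / (w * τ ^ 2) + 2) * (3 * (‖d₁‖ ^ 2 + ‖d₂‖ ^ 2 + ‖d₃‖ ^ 2)) :=
    mul_le_mul_of_nonneg_left y4 (by positivity)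
  have y6 := mul_le_mul_of_nonneg_right hfac (sq_nonneg ‖c‖)
  have e6 : S ^ 2 / (w * τ ^ 2) = 1 / (w * τ ^ 2) * S ^ 2 := by ring
  rw [hexp]
  rw [e6] at y1
  linarith

/-- The dissipation of the heat flow over one step, in `H¹`. -/
def dissip (ν : ℝ) (M : ℕ) (τ : ℝ) (c : ℤ → ℂ) : ℝ :=
  ∑ k ∈ Finset.Icc (-(M : ℤ)) (M : ℤ), (1 + (k : ℝ) ^ 2) * (ν * τ * (k : ℝ) ^ 2 * ‖c k‖ ^ 2)

/-- Here (fac b z − 1)² ≤ z² ≤ νl·z: one factor z is spent on the CFL bound, the other makes up the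
dissipation. No additional smoothness of the data is used, since the dissipation reappears with a
negative sign in the energy estimate. -/
lemma yNorm_fac_sub_le {ν l τ : ℝ} {M : ℕ} (hp : Params ν l M τ) {b : ℝ} (hb0 : 0 ≤ b)
    (hb1 : b ≤ 1) (c : ℤ → ℂ) :
    yNorm M (fun k : ℤ => (fac b (ν * τ * (k : ℝ) ^ 2) : ℂ) * c k - c k) ≤ ν * l * dissip ν M τ c := by
  rw [yNorm_eq, dissip, Finset.mul_sum]
  refine Finset.sum_le_sum fun k hk => ?_
  obtain ⟨hz0, hzZ, -⟩ := heat_arg_bounds hp.ν_pos hp.τ_pos hp.cfl hk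
  set z := ν * τ * (k : ℝ) ^ 2
  have e : (fac b z : ℂ) * c k - c k = ((fac b z - 1 : ℝ) : ℂ) * c k := by push_cast; ring
  have h1 : |fac b z - 1| ≤ z :=
    (abs_fac_sub_one_le hb0 hz0).trans (mul_le_of_le_one_left hz0 hb1)
  have h2 : |fac b z - 1| ^ 2 ≤ ν * l * z :=
    (pow_le_pow_left₀ (abs_nonneg _) h1 2).trans (by nlinarith)
  rw [e, norm_mul, Complex.norm_real, Real.norm_eq_abs, mul_pow]
  calc (1 + (k : ℝ) ^ 2) * (|fac b z - 1| ^ 2 * ‖c k‖ ^ 2)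
      ≤ (1 + (k : ℝ) ^ 2) * (ν * l * z * ‖c k‖ ^ 2) := by gcongr
    _ = _ := by ring

lemma yNorm_le_of_norm_le {M : ℕ} {c d : ℤ → ℂ} {κ : ℝ}
    (h : ∀ k ∈ Finset.Icc (-(M : ℤ)) M, ‖d k‖ ≤ κ * ‖c k‖) : yNorm M d ≤ κ ^ 2 * yNorm M c := by
  unfold yNorm
  linarith [hNorm_le_of_norm_le (s := 0) h, hNorm_le_of_norm_le (s := 1) h]

lemma dissip_nonneg {ν τ : ℝ} (hν : 0 < ν) (hτ : 0 < τ) (M : ℕ) (c : ℤ → ℂ) :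
    0 ≤ dissip ν M τ c :=
  Finset.sum_nonneg fun _ _ => by positivity

/-- The stages deviate little from the initial value of the step. -/
lemma yNorm_stage_sub_le {ν l τ : ℝ} {M : ℕ} (hp : Params ν l M τ) (c : ℤ → ℂ) {G : ℝ}
    (h1 : yNorm M (inc1 ν M τ c) ≤ G) (h2 : yNorm M (inc2 ν M τ c) ≤ G) :
    yNorm M (fun k => stage1 ν τ c k - c k) ≤
        2 * (ν * l * dissip ν M τ c) + 8 * (Real.exp (ν * l) ^ 2 * G) ∧
      yNorm M (fun k => stage2 ν M τ c k - c k) ≤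
        2 * (ν * l * dissip ν M τ c) + 8 * (Real.exp (ν * l) ^ 2 * G) ∧
      yNorm M (fun k => stage3 ν M τ c k - c k) ≤
        2 * (ν * l * dissip ν M τ c) + 8 * (Real.exp (ν * l) ^ 2 * G) := by
  have hx1 := one_le_x₁
  have hx2 := x₁_le
  set κ := Real.exp (ν * l)
  have hD : 0 ≤ ν * l * dissip ν M τ c :=
    mul_nonneg (mul_nonneg hp.ν_pos.le hp.l_pos.le) (dissip_nonneg hp.ν_pos hp.τ_pos M c)
  have hG : 0 ≤ κ ^ 2 * G := mul_nonneg (sq_nonneg _) ((yNorm_nonneg _ _).trans h1)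
  have hfac : ∀ (θ : ℝ) (g : ℤ → ℂ), -1 ≤ θ → yNorm M g ≤ G →
      yNorm M (fun k : ℤ => (fac θ (ν * τ * (k : ℝ) ^ 2) : ℂ) * g k) ≤ κ ^ 2 * G := fun θ g hθ hg => by
    refine (yNorm_le_of_norm_le (κ := κ) (c := g) fun k hk => ?_).trans
      (mul_le_mul_of_nonneg_left hg (sq_nonneg _))
    obtain ⟨hz0, hzZ, -⟩ := heat_arg_bounds hp.ν_pos hp.τ_pos hp.cfl hk
    rw [norm_fac_mul]
    exact mul_le_mul_of_nonneg_right (fac_le hθ hz0 hzZ) (norm_nonneg _)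
  refine ⟨?_, ?_, ?_⟩
  · have := yNorm_fac_sub_le hp (b := x₁ / 2) (by linarith) (by linarith) c
    rw [funext (stage1_apply ν τ c)]
    linarith
  · have e : (fun k => stage2 ν M τ c k - c k) = fun k : ℤ =>
        ((fac (1 / 2) (ν * τ * (k : ℝ) ^ 2) : ℂ) * c k - c k) +
          (fac ((1 - x₁) / 2) (ν * τ * (k : ℝ) ^ 2) : ℂ) * inc1 ν M τ c k := by
      ext k; rw [stage2_apply]; ring
    have i1 := yNorm_fac_sub_le hp (b := 1 / 2) (by norm_num) (by norm_num) c
    have i2 := hfac ((1 - x₁) / 2) _ (by linarith) h1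
    rw [e]
    exact (yNorm_add_le _ _ _).trans (by linarith)
  · have e : (fun k => stage3 ν M τ c k - c k) = fun k : ℤ =>
        ((fac (1 - x₁ / 2) (ν * τ * (k : ℝ) ^ 2) : ℂ) * c k - c k) +
          ((fac (1 - x₁) (ν * τ * (k : ℝ) ^ 2) : ℂ) * inc1 ν M τ c k +
            (fac ((1 - x₁) / 2) (ν * τ * (k : ℝ) ^ 2) : ℂ) * inc2 ν M τ c k) := by
      ext k; rw [stage3_apply']; ring
    have i1 := yNorm_fac_sub_le hp (b := 1 - x₁ / 2) (by linarith) (by linarith) c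
    have i2 := hfac (1 - x₁) _ (by linarith) h1
    have i3 := hfac ((1 - x₁) / 2) _ (by linarith) h2
    have i4 := yNorm_add_le M (fun k : ℤ => (fac (1 - x₁) (ν * τ * (k : ℝ) ^ 2) : ℂ) * inc1 ν M τ c k)
      (fun k : ℤ => (fac ((1 - x₁) / 2) (ν * τ * (k : ℝ) ^ 2) : ℂ) * inc2 ν M τ c k)
    rw [e]
    exact (yNorm_add_le _ _ _).trans (by linarith)

/-- The level below which the squared `H¹` norm need not decrease. -/
def absorbLevel (ν l : ℝ) : ℝ := (3 + 9 / (2 * (Real.exp (-(2 * (ν * l))) * ν))) ^ 2 + 1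

/-- Low frequencies are controlled by the cubic damping, high ones by the diffusion. -/
lemma damping_le {ν l τ : ℝ} (hν : 0 < ν) (hτ : 0 < τ) (M : ℕ) (c : ℤ → ℂ) :
    -(Real.exp (-(2 * (ν * l))) / 2) * dissip ν M τ c + 2 * τ * (yNorm M c - hNorm M 0 c ^ 2) ≤
      τ * (absorbLevel ν l - 1 - yNorm M c) := by
  set η := Real.exp (-(2 * (ν * l))) with hη'
  have hη : 0 < η := Real.exp_pos _
  set K := 3 + 9 / (2 * (η * ν)) with hK
  have key : ∀ k ∈ Finset.Icc (-(M : ℤ)) (M : ℤ),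
      3 * τ * ((1 + (k : ℝ) ^ 2) * ‖c k‖ ^ 2) ≤
      τ * K * ((k : ℝ) ^ (2 * 0) * ‖c k‖ ^ 2) +
        η / 2 * ((1 + (k : ℝ) ^ 2) * (ν * τ * (k : ℝ) ^ 2 * ‖c k‖ ^ 2)) := fun k _ => by
    -- Two of the three copies of Y pay for the production 2τY, the third leaves −τY behind. The
    -- term 9/(2ην) in K is Young's inequality for 3k².
    have : 3 * (1 + (k : ℝ) ^ 2) ≤ K + η * ν / 2 * ((1 + (k : ℝ) ^ 2) * (k : ℝ) ^ 2) := by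
      have hβ : 0 < η * ν := by positivity
      have := two_mul_norm_le_of_pos (a := (k : ℝ) ^ 2) (b := 3) hβ
      have e : (3 : ℝ) ^ 2 / (η * ν) = 2 * (9 / (2 * (η * ν))) := by field_simp; norm_num
      have e2 : 0 ≤ η * ν * (k : ℝ) ^ 2 := by positivity
      rw [e] at this
      rw [hK]
      nlinarith
    have := mul_le_mul_of_nonneg_left this (by positivity : 0 ≤ τ * ‖c k‖ ^ 2)
    rw [mul_zero, pow_zero]
    linarith
  have hsum := Finset.sum_le_sum key
  simp only [Finset.sum_add_distrib, ← Finset.mul_sum] at hsum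
  change 3 * τ * _ ≤ τ * K * hNorm M 0 c + η / 2 * dissip ν M τ c at hsum
  rw [← yNorm_eq] at hsum
  have hsq : τ * K * hNorm M 0 c ≤ τ * (K ^ 2 + 2 * hNorm M 0 c ^ 2) := by
    rw [mul_assoc]
    refine mul_le_mul_of_nonneg_left ?_ hτ.le
    nlinarith [sq_nonneg (K - hNorm M 0 c), sq_nonneg (hNorm M 0 c)]
  have : absorbLevel ν l - 1 = K ^ 2 := by rw [absorbLevel, ← hη', ← hK]; ring
  rw [this]
  linarith

lemma exists_yNorm_cubic_le (B : ℝ) : ∃ C, 0 ≤ C ∧ ∀ (M : ℕ) (c : ℤ → ℂ), Herm c →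
    yNorm M c ≤ B → yNorm M (coeff fun x => cubic (truncSum M c x)) ≤ C := by
  rcases lt_or_ge B 0 with hB | hB
  · exact ⟨0, le_rfl, fun M c _ h => absurd ((yNorm_nonneg M c).trans h) (not_le.2 hB)⟩
  obtain ⟨C, hC, h⟩ := exists_yNorm_cubic_sub_le B
  refine ⟨C * B, by positivity, fun M c hc hy => ?_⟩
  have h0 : Herm fun _ => 0 := fun k => by simp
  have hy0 : yNorm M (fun _ => 0) = 0 := by simp [yNorm, hNorm]
  have := h M c (fun _ => 0) hc h0 hy (hy0.le.trans hB)
  have e : ∀ x, truncSum M (fun _ => 0) x = 0 := fun x => by simp [truncSum]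
  simp only [e, cubic, sub_zero, ne_eq, OfNat.ofNat_ne_zero, not_false_eq_true, zero_pow] at this
  exact this.trans (mul_le_mul_of_nonneg_left hy hC)

/-- The increments agree with their first-order expansions at the initial value of the step. -/
lemma exists_inc_sub_bounds {ν l : ℝ} (hν : 0 < ν) (hl : 0 < l) {B : ℝ} (hB : 0 ≤ B) :
    ∃ C T, 0 ≤ C ∧ 0 < T ∧
    ∀ (M : ℕ) (τ : ℝ) (c : ℤ → ℂ), Params ν l M τ → τ ≤ T → Herm c → yNorm M c ≤ B →
      StepAdmissible ν M τ c ∧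
      yNorm M (fun k => inc1 ν M τ c k - (x₁ * τ : ℝ) * coeff (fun x => cubic (truncSum M c x)) k) ≤
        C * (τ ^ 4 + τ ^ 2 * dissip ν M τ c) ∧
      yNorm M (fun k => inc2 ν M τ c k - (-x₀ * τ : ℝ) * coeff (fun x => cubic (truncSum M c x)) k) ≤
        C * (τ ^ 4 + τ ^ 2 * dissip ν M τ c) ∧
      yNorm M (fun k => inc3 ν M τ c k - (x₁ * τ : ℝ) * coeff (fun x => cubic (truncSum M c x)) k) ≤
        C * (τ ^ 4 + τ ^ 2 * dissip ν M τ c) := by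
  -- At s = 0 the norm `wNorm` counts the L² part twice, hence 2 * B.
  obtain ⟨C, hC, h⟩ := exists_stage_bounds ν l 0 (B := 2 * B) (by positivity)
  obtain ⟨C', hC', h'⟩ := exists_yNorm_incr_sub_le (max B C)
  set κ := Real.exp (ν * l)
  have hE := embConst_pos
  refine ⟨C' * (16 + 4 * (2 * (ν * l) + 8 * (κ ^ 2 * C))), 1 / (16 * (embConst * C) + 1),
    by positivity, by positivity, ?_⟩
  intro M τ c hp hτ hc hy
  have hτ0 := hp.τ_pos
  have hx1 := one_le_x₁
  have hx2 := x₁_le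
  have hsmall : ∀ θ : ℝ, |θ| ≤ 2 → |θ * τ| * (embConst * C) ≤ 1 / 8 := fun θ hθ => by
    rw [le_div_iff₀ (by positivity)] at hτ
    rw [abs_mul, abs_of_pos hτ0]
    have : 0 ≤ τ * (embConst * C) := by positivity
    nlinarith
  have hθ1 : |x₁| ≤ 2 := by rw [abs_of_nonneg (by linarith)]; linarith
  have hθ2 : |-x₀| ≤ 2 := by rw [abs_neg, x₀_eq, abs_of_nonneg (by linarith)]; linarith
  have hw : wNorm M 0 c ≤ 2 * B := by
    have : hNorm M 0 c ≤ yNorm M c := le_add_of_nonneg_right (hNorm_nonneg _ _ _)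
    unfold wNorm; linarith
  obtain ⟨w1, r1⟩ := h M τ c hp hc hw
  have y1 := (yNorm_le_wNorm _ _ _).trans w1
  have a1 : Admissible (x₁ * τ) (truncSum M (stage1 ν τ c)) :=
    admissible_of_yNorm_le y1 (hsmall _ hθ1)
  obtain ⟨g1, w2, r2⟩ := r1 a1
  have y2 := (yNorm_le_wNorm _ _ _).trans w2
  have a2 : Admissible (-x₀ * τ) (truncSum M (stage2 ν M τ c)) :=
    admissible_of_yNorm_le y2 (hsmall _ hθ2)
  obtain ⟨g2, w3, -⟩ := r2 a2
  have y3 := (yNorm_le_wNorm _ _ _).trans w3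
  have a3 : Admissible (x₁ * τ) (truncSum M (stage3 ν M τ c)) :=
    admissible_of_yNorm_le y3 (hsmall _ hθ1)
  obtain ⟨s1, s2, s3⟩ := yNorm_stage_sub_le hp c ((yNorm_le_wNorm _ _ _).trans g1)
    ((yNorm_le_wNorm _ _ _).trans g2)
  have hD := dissip_nonneg hν hτ0 M c
  have fin : ∀ t v : ℝ, t ^ 2 ≤ 4 * τ ^ 2 → 0 ≤ v →
      v ≤ 2 * (ν * l * dissip ν M τ c) + 8 * (κ ^ 2 * (C * τ ^ 2)) →
      C' * (t ^ 4 + t ^ 2 * v) ≤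
        C' * (16 + 4 * (2 * (ν * l) + 8 * (κ ^ 2 * C))) * (τ ^ 4 + τ ^ 2 * dissip ν M τ c) := by
    intro t v ht hv0 hv
    rw [mul_assoc]
    refine mul_le_mul_of_nonneg_left ?_ hC'
    have i1 : t ^ 4 ≤ 16 * τ ^ 4 := by nlinarith [sq_nonneg t, sq_nonneg τ]
    have i2 : t ^ 2 * v ≤ 4 * τ ^ 2 * (2 * (ν * l * dissip ν M τ c) + 8 * (κ ^ 2 * (C * τ ^ 2))) :=
      mul_le_mul ht hv hv0 (by positivity)
    have i3 : 0 ≤ τ ^ 2 * dissip ν M τ c := by positivity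
    have i4 : 0 ≤ 8 * (κ ^ 2 * C) * (τ ^ 2 * dissip ν M τ c) := by positivity
    have i5 : 0 ≤ ν * l * τ ^ 4 := by positivity
    nlinarith
  have hyB := hy.trans (le_max_left B C)
  refine ⟨⟨a1, a2, a3⟩, ?_, ?_, ?_⟩
  · exact (h' M _ c _ (herm_stage1 hc _ _) hc hp.abs_x₁_mul_le a1 (y1.trans (le_max_right _ _))
      hyB).trans (fin _ _ (x₁_mul_sq_le τ) (yNorm_nonneg _ _) s1)
  · exact (h' M _ c _ (herm_stage2 hc _ _ _) hc hp.abs_x₀_mul_le a2 (y2.trans (le_max_right _ _))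
      hyB).trans (fin _ _ (x₀_mul_sq_le τ) (yNorm_nonneg _ _) s2)
  · exact (h' M _ c _ (herm_stage3 hc _ _ _) hc hp.abs_x₁_mul_le a3 (y3.trans (le_max_right _ _))
      hyB).trans (fin _ _ (x₁_mul_sq_le τ) (yNorm_nonneg _ _) s3)

/-- The energy estimate for one step, in `H¹`. -/
lemma yNorm_step4_le {ν l τ w : ℝ} {M : ℕ} (hp : Params ν l M τ) (hw : 0 < w) {c : ℤ → ℂ}
    (hc : Herm c) {D H : ℝ}
    (d1 : yNorm M (fun k => inc1 ν M τ c k -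
      (x₁ * τ : ℝ) * coeff (fun x => cubic (truncSum M c x)) k) ≤ D)
    (d2 : yNorm M (fun k => inc2 ν M τ c k -
      (-x₀ * τ : ℝ) * coeff (fun x => cubic (truncSum M c x)) k) ≤ D)
    (d3 : yNorm M (fun k => inc3 ν M τ c k -
      (x₁ * τ : ℝ) * coeff (fun x => cubic (truncSum M c x)) k) ≤ D)
    (hH : yNorm M (coeff fun x => cubic (truncSum M c x)) ≤ H) :
    yNorm M (step4 ν M τ c) ≤ (1 + w * τ ^ 2) * yNorm M c -
      Real.exp (-(2 * (ν * l))) * dissip ν M τ c + 2 * τ * (yNorm M c - hNorm M 0 c ^ 2) +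
      9 * (1 / (w * τ ^ 2) + 2) * D +
      (144 / Real.exp (-(2 * (ν * l))) * (ν * l) + 72) * τ ^ 2 * H := by
  set η := Real.exp (-(2 * (ν * l)))
  have hη : 0 < η := Real.exp_pos _
  have hτ0 := hp.τ_pos
  have hν := hp.ν_pos
  have hl := hp.l_pos
  have hx1 := one_le_x₁
  have hx2 := x₁_le
  have hθ1 : |x₁| ≤ 2 := by rw [abs_of_nonneg (by linarith)]; linarith
  have hθ2 : |-x₀| ≤ 2 := by rw [abs_neg, x₀_eq, abs_of_nonneg (by linarith)]; linarith
  have hcross := mul_le_mul_of_nonneg_left (sum_cubic_le M hc) (by positivity : 0 ≤ 2 * τ)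
  generalize (coeff fun x => cubic (truncSum M c x)) = h at *
  have key : ∀ k ∈ Finset.Icc (-(M : ℤ)) (M : ℤ),
      (1 + (k : ℝ) ^ 2) * ‖step4 ν M τ c k‖ ^ 2 ≤
      (1 + w * τ ^ 2) * ((1 + (k : ℝ) ^ 2) * ‖c k‖ ^ 2) -
      η * ((1 + (k : ℝ) ^ 2) * (ν * τ * (k : ℝ) ^ 2 * ‖c k‖ ^ 2)) +
      2 * τ * ((1 + (k : ℝ) ^ 2) * (starRingEnd ℂ (c k) * h k).re) +
      3 * (1 / (w * τ ^ 2) + 2) * ((1 + (k : ℝ) ^ 2) * ‖inc1 ν M τ c k - (x₁ * τ : ℝ) * h k‖ ^ 2 +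
        (1 + (k : ℝ) ^ 2) * ‖inc2 ν M τ c k - (-x₀ * τ : ℝ) * h k‖ ^ 2 +
        (1 + (k : ℝ) ^ 2) * ‖inc3 ν M τ c k - (x₁ * τ : ℝ) * h k‖ ^ 2) +
      (144 / η * (ν * l) + 72) * τ ^ 2 * ((1 + (k : ℝ) ^ 2) * ‖h k‖ ^ 2) := fun k hk => by
    obtain ⟨hz0, hzZ, -⟩ := heat_arg_bounds hν hτ0 hp.cfl hk
    have n := norm_sq_step_le hη hz0 hτ0 hw (fac_one_sq_le hz0 hzZ)
      (a₁ := 1 - x₁ / 2) (a₂ := 1 / 2) (a₃ := x₁ / 2) ⟨by linarith, by linarith⟩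
      ⟨by norm_num, by norm_num⟩ ⟨by linarith, by linarith⟩ hθ1 hθ2 hθ1 (by rw [x₀_eq]; ring)
      (c k) (h k) (inc1 ν M τ c k) (inc2 ν M τ c k) (inc3 ν M τ c k)
    rw [← step4_apply] at n
    have n2 : (144 / η * (ν * τ * (k : ℝ) ^ 2) + 72) * τ ^ 2 * ‖h k‖ ^ 2 ≤
        (144 / η * (ν * l) + 72) * τ ^ 2 * ‖h k‖ ^ 2 := by gcongr
    have n3 := mul_le_mul_of_nonneg_left (n.trans (add_le_add le_rfl n2))
      (by positivity : 0 ≤ 1 + (k : ℝ) ^ 2)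
    refine n3.trans (le_of_eq ?_)
    ring
  have hsum := Finset.sum_le_sum key
  simp only [Finset.sum_add_distrib, Finset.sum_sub_distrib, ← Finset.mul_sum] at hsum
  rw [← yNorm_eq M (step4 ν M τ c), ← yNorm_eq M c, ← yNorm_eq M h,
    ← yNorm_eq M fun k => inc1 ν M τ c k - (x₁ * τ : ℝ) * h k,
    ← yNorm_eq M fun k => inc2 ν M τ c k - (-x₀ * τ : ℝ) * h k,
    ← yNorm_eq M fun k => inc3 ν M τ c k - (x₁ * τ : ℝ) * h k] at hsum
  have i1 := mul_le_mul_of_nonneg_left (add_le_add (add_le_add d1 d2) d3)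
    (by positivity : 0 ≤ 3 * (1 / (w * τ ^ 2) + 2))
  have i2 := mul_le_mul_of_nonneg_left hH
    (by positivity : 0 ≤ (144 / η * (ν * l) + 72) * τ ^ 2)
  have e : η * dissip ν M τ c = η * ∑ k ∈ Finset.Icc (-(M : ℤ)) (M : ℤ),
    (1 + (k : ℝ) ^ 2) * (ν * τ * (k : ℝ) ^ 2 * ‖c k‖ ^ 2) := rfl
  rw [e]
  linarith

/-- The deviations are absorbed by the dissipation, if the weight is large and the step small. -/
lemma deviation_le {η C w τ Q : ℝ} (hη : 0 < η) (hC : 0 ≤ C) (hw : w = 36 * C / η + 1)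
    (hτ0 : 0 < τ) (hτ1 : τ ≤ 1 / 2) (hτC : τ ≤ η / (72 * C + 1)) (hQ : 0 ≤ Q) :
    9 * (1 / (w * τ ^ 2) + 2) * (C * (τ ^ 4 + τ ^ 2 * Q)) ≤ η / 2 * (τ ^ 2 + Q) := by
  have hw0 : 0 < w := by rw [hw]; positivity
  -- The common factor τ² of the deviations cancels the singular weight; w is chosen so that 9C/w ≤
  -- η/4, and the bound on τ does the same for the other term.
  have i2 : 9 * (1 / (w * τ ^ 2) + 2) * (C * (τ ^ 4 + τ ^ 2 * Q)) =
      (9 * C / w + 18 * C * τ ^ 2) * (τ ^ 2 + Q) := by field_simp; ring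
  have i3 : 9 * C / w ≤ η / 4 := by
    rw [div_le_iff₀ hw0, hw]
    have : η / 4 * (36 * C / η + 1) = 9 * C + η / 4 := by field_simp; ring
    linarith
  have i4 : 18 * C * τ ^ 2 ≤ η / 4 := by
    rw [le_div_iff₀ (by positivity)] at hτC
    have : τ ^ 2 ≤ τ := by nlinarith
    nlinarith
  rw [i2]
  exact mul_le_mul_of_nonneg_right (by linarith) (by positivity)

/-- One step does not increase the `H¹` norm above the absorbing level. -/
lemma exists_step_bound {ν l : ℝ} (hν : 0 < ν) (hl : 0 < l) {B : ℝ} (hB : 0 ≤ B) :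
    ∃ T, 0 < T ∧ ∀ (M : ℕ) (τ : ℝ) (c : ℤ → ℂ), Params ν l M τ → τ ≤ T → Herm c →
      yNorm M c ≤ B → StepAdmissible ν M τ c ∧
        yNorm M (step4 ν M τ c) ≤ max (yNorm M c) (absorbLevel ν l) := by
  obtain ⟨C, T, hC, hT, h⟩ := exists_inc_sub_bounds hν hl hB
  obtain ⟨H, hH, hcub⟩ := exists_yNorm_cubic_le B
  set η := Real.exp (-(2 * (ν * l))) with hη'
  have hη : 0 < η := Real.exp_pos _
  set w := 36 * C / η + 1 with hw'
  have hw : 0 < w := by positivity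
  set E := w * B + η / 2 + (144 / η * (ν * l) + 72) * H with hE'
  have hE : 0 ≤ E := by positivity
  refine ⟨min T (min (1 / (E + 1)) (η / (72 * C + 1))), by positivity, ?_⟩
  intro M τ c hp hτ hc hy
  have hτ0 := hp.τ_pos
  have hτT := hτ.trans (min_le_left _ _)
  have hτE := hτ.trans ((min_le_right _ _).trans (min_le_left _ _))
  have hτC := hτ.trans ((min_le_right _ _).trans (min_le_right _ _))
  obtain ⟨ha, d1, d2, d3⟩ := h M τ c hp hτT hc hy
  refine ⟨ha, ?_⟩
  have main := yNorm_step4_le hp hw hc d1 d2 d3 (hcub M c hc hy)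
  rw [← hη'] at main
  have hQ : 0 ≤ dissip ν M τ c := dissip_nonneg hν hτ0 M c
  have hdamp := damping_le (l := l) hν hτ0 M c
  rw [← hη'] at hdamp
  have hdev := deviation_le hη hC hw' hτ0 hp.τ_le hτC hQ
  have hwB : w * τ ^ 2 * yNorm M c ≤ w * τ ^ 2 * B :=
    mul_le_mul_of_nonneg_left hy (by positivity)
  have hfinal : yNorm M (step4 ν M τ c) ≤
      yNorm M c + τ * (absorbLevel ν l - 1 - yNorm M c) + E * τ ^ 2 := by
    rw [hE']
    linarith
  -- The unit built into `absorbLevel` pays for all errors quadratic in τ.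
  have hEτ : E * τ ^ 2 ≤ τ := by
    rw [le_div_iff₀ (by positivity)] at hτE
    nlinarith
  have hstep : yNorm M (step4 ν M τ c) ≤ yNorm M c + τ * (absorbLevel ν l - yNorm M c) := by
    linarith
  rcases le_total (absorbLevel ν l) (yNorm M c) with hcase | hcase
  · exact le_max_of_le_left (by nlinarith)
  -- Below the level the new bound is a convex combination of Y and the level, because τ ≤ 1.
  · exact le_max_of_le_right (by nlinarith [hp.τ_le])

end

/-! ### Induction on the Sobolev order and assembly of the constants -/

section

open Set MeasureTheory

/-- Uniform bounds of every order for iterates that stay bounded in `H¹`. -/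
lemma exists_hNorm_bound {ν l : ℝ} (hν : 0 < ν) (hl : 0 < l) {R : ℝ} (hR : 0 ≤ R) {s : ℕ}
    (hs : 1 ≤ s) : ∃ A, 0 ≤ A ∧ ∀ (M : ℕ) (τ : ℝ) (c : ℕ → ℤ → ℂ), Params ν l M τ →
      (∀ n, Herm (c n)) → (∀ n, StepAdmissible ν M τ (c n)) →
      (∀ n, c (n + 1) = step4 ν M τ (c n)) → (∀ n, yNorm M (c n) ≤ R) →
      hNorm M s (c 0) ≤ R → ∀ n, hNorm M s (c n) ≤ A := by
  induction s, hs using Nat.le_induction with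
  | base =>
    refine ⟨R, hR, fun M τ c _ _ _ _ hy _ n => ?_⟩
    exact (le_add_of_nonneg_left (hNorm_nonneg _ _ _)).trans (hy n)
  | succ s hs ih =>
    obtain ⟨A, hA, h⟩ := ih
    obtain ⟨A', hA', h'⟩ := exists_hNorm_succ_bound hν hl hs (B := R + A) (by positivity)
    refine ⟨A', hA', fun M τ c hp hc ha hstep hy h0 => ?_⟩
    have hsb := h M τ c hp hc ha hstep hy ((hNorm_mono_order M hs (Nat.le_succ s) _).trans h0)
    exact h' M τ c hp hc ha hstep (fun n => add_le_add (hy n) (hsb n))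
      (h0.trans (le_add_of_nonneg_right hA))

/-- The iterates in terms of coefficients. -/
def coeffIter (ν : ℝ) (M : ℕ) (τ : ℝ) (a : Torus → ℝ) : ℕ → ℤ → ℂ
  | 0 => coeff a
  | n + 1 => step4 ν M τ (coeffIter ν M τ a n)

lemma herm_coeffIter (ν : ℝ) (M : ℕ) (τ : ℝ) (a : Torus → ℝ) (n : ℕ) :
    Herm (coeffIter ν M τ a n) := by
  induction n with
  | zero => exact herm_coeff a
  | succ n ih => exact herm_step4 ih _ _ _

lemma isIterates_iff {ν : ℝ} {M : ℕ} {τ : ℝ} {a : Torus → ℝ}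
    (ha : ∀ n, StepAdmissible ν M τ (coeffIter ν M τ a n)) (u : ℕ → Torus → ℝ) :
    IsIterates ν M τ a u ↔ u = fun n => truncSum M (coeffIter ν M τ a n) := by
  constructor
  · rintro ⟨h0, h⟩
    ext1 n
    induction n with
    | zero => exact h0
    | succ n ih =>
      have := h n
      rwa [ih, isStep4_iff (herm_coeffIter ν M τ a n) (ha n)] at this
  · rintro rfl
    exact ⟨rfl, fun n => (isStep4_iff (herm_coeffIter ν M τ a n) (ha n) _).2 rfl⟩

lemma memSobolev_truncSum {c : ℤ → ℂ} (hc : Herm c) (M s : ℕ) :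
    MemSobolev s (truncSum M c) := by
  refine ⟨memLp_of_continuous (continuous_truncSum M c), ?_⟩
  refine summable_of_ne_finset_zero (s := Finset.Icc (-(M : ℤ)) M) fun k hk => ?_
  rw [coeff_truncSum_of_notMem hc hk]; simp

lemma abs_pow_two_mul (x : ℝ) (s : ℕ) : |x| ^ (2 * s) = x ^ (2 * s) := by
  rw [pow_mul, sq_abs, pow_mul]

lemma sobolevNorm_truncSum {c : ℤ → ℂ} (hc : Herm c) (M s : ℕ) :
    sobolevNorm s (truncSum M c) ^ 2 = 2 * Real.pi * (hNorm M 0 c + hNorm M s c) := by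
  have h : ∑' k : ℤ, |(k : ℝ)| ^ (2 * s) * ‖coeff (truncSum M c) k‖ ^ 2 = hNorm M s c := by
    rw [tsum_eq_sum (s := Finset.Icc (-(M : ℤ)) M) fun k hk => by
      rw [coeff_truncSum_of_notMem hc hk]; simp]
    exact Finset.sum_congr rfl fun k hk => by rw [coeff_truncSum hc hk, abs_pow_two_mul]
  have h0 := hNorm_nonneg M 0 c
  have hs := hNorm_nonneg M s c
  have hpi := Real.pi_pos
  rw [sobolevNorm, h, integral_eq_avg, avg_truncSum_sq hc, Real.sq_sqrt (by positivity)]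
  ring

lemma yNorm_coeff_le {a : Torus → ℝ} (ha : MemSobolev 1 a) (M : ℕ) :
    yNorm M (coeff a) ≤ sobolevNorm 1 a ^ 2 := by
  have hpi := Real.pi_gt_three
  have h0 : hNorm M 0 (coeff a) ≤ avg fun x => a x ^ 2 := by
    refine le_trans (le_of_eq ?_) (bessel ha.1 (Finset.Icc (-(M : ℤ)) M))
    exact Finset.sum_congr rfl fun k _ => by simp
  have h1 : hNorm M 1 (coeff a) ≤ ∑' k : ℤ, |(k : ℝ)| ^ (2 * 1) * ‖coeff a k‖ ^ 2 := by
    refine le_trans (le_of_eq ?_) (ha.2.sum_le_tsum (Finset.Icc (-(M : ℤ)) M)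
      fun k _ => by positivity)
    exact Finset.sum_congr rfl fun k _ => by rw [abs_pow_two_mul]
  have n0 := hNorm_nonneg M 0 (coeff a)
  have n1 := hNorm_nonneg M 1 (coeff a)
  have m0 := n0.trans h0
  have m1 := n1.trans h1
  rw [sobolevNorm, integral_eq_avg, Real.sq_sqrt (by positivity), yNorm]
  nlinarith

lemma absorbLevel_pos (ν l : ℝ) : 0 < absorbLevel ν l := by unfold absorbLevel; positivity

/-- The admissible time step and the boundedness of the iterates in `H¹`. -/
lemma exists_timestep (l γ ν : ℝ) : ∃ T : ℝ, 0 < l → 0 ≤ γ → 0 < ν → 0 < T ∧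
    ∀ (M : ℕ) (a : Torus → ℝ) (τ : ℝ), MemSobolev 1 a → sobolevNorm 1 a = γ → 0 < τ →
      τ * (M : ℝ) ^ 2 ≤ l → τ ≤ T → Params ν l M τ ∧ ∀ n,
        StepAdmissible ν M τ (coeffIter ν M τ a n) ∧
        yNorm M (coeffIter ν M τ a n) ≤ max (yNorm M (coeff a)) (absorbLevel ν l) := by
  -- The existential precedes the sign conditions so that `choose` gives functions of unrestricted
  -- real arguments; 0 is a dummy value outside their range.
  by_cases hpos : 0 < l ∧ 0 ≤ γ ∧ 0 < ν
  swap
  · exact ⟨0, fun h1 h2 h3 => absurd ⟨h1, h2, h3⟩ hpos⟩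
  obtain ⟨hl, hγ, hν⟩ := hpos
  -- This threshold is invariant under the step, so T depends only on γ, ν and l. The bound asserted
  -- for the iterates starts from the truncated data instead, so that later constants depend on u⁰
  -- alone.
  obtain ⟨T, hT, h⟩ := exists_step_bound hν hl (B := max (γ ^ 2) (absorbLevel ν l)) (by positivity)
  refine ⟨min T (1 / 2), fun _ _ _ => ⟨by positivity, ?_⟩⟩
  intro M a τ ha hγa hτ hM hτT
  have hp : Params ν l M τ := ⟨hν, hl, hτ, hτT.trans (min_le_right _ _), hM⟩
  have h0 : max (yNorm M (coeff a)) (absorbLevel ν l) ≤ max (γ ^ 2) (absorbLevel ν l) :=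
    max_le_max (hγa ▸ yNorm_coeff_le ha M) le_rfl
  have hy : ∀ n, yNorm M (coeffIter ν M τ a n) ≤ max (yNorm M (coeff a)) (absorbLevel ν l) := by
    intro n
    induction n with
    | zero => exact le_max_left _ _
    | succ n ih =>
      refine (h M τ _ hp (hτT.trans (min_le_left _ _)) (herm_coeffIter ν M τ a n)
        (ih.trans h0)).2.trans ?_
      exact max_le ih (le_max_right _ _)
  exact ⟨hp, fun n => ⟨(h M τ _ hp (hτT.trans (min_le_left _ _)) (herm_coeffIter ν M τ a n)
    ((hy n).trans h0)).1, hy n⟩⟩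

/-- The bound for the iterates in the Sobolev norm of a given order. -/
lemma exists_sobolevNorm_bound (R ν l : ℝ) (s : ℕ) : ∃ A : ℝ, 0 ≤ R → 0 < ν → 0 < l → 1 ≤ s →
    0 < A ∧ ∀ (M : ℕ) (τ : ℝ) (a : Torus → ℝ), Params ν l M τ →
      (∀ n, StepAdmissible ν M τ (coeffIter ν M τ a n)) →
      (∀ n, yNorm M (coeffIter ν M τ a n) ≤ max (yNorm M (coeff a)) (absorbLevel ν l)) →
      sobolevNorm s (truncSum M (coeff a)) = R →
      ∀ n, sobolevNorm s (truncSum M (coeffIter ν M τ a n)) ≤ A := by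
  by_cases hpos : 0 ≤ R ∧ 0 < ν ∧ 0 < l ∧ 1 ≤ s
  swap
  · exact ⟨0, fun h1 h2 h3 h4 => absurd ⟨h1, h2, h3, h4⟩ hpos⟩
  obtain ⟨hR, hν, hl, hs⟩ := hpos
  have hpi := Real.pi_gt_three
  set B := max (R ^ 2) (absorbLevel ν l)
  have hB : 0 < B := lt_max_of_lt_right (absorbLevel_pos ν l)
  obtain ⟨A, hA, h⟩ := exists_hNorm_bound hν hl hB.le hs
  refine ⟨√(2 * Real.pi * (B + A)), fun _ _ _ _ => ⟨by positivity, ?_⟩⟩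
  intro M τ a hp hadm hy hRa n
  have e0 := sobolevNorm_truncSum (herm_coeff a) M s
  rw [hRa] at e0
  have n0 := hNorm_nonneg M 0 (coeff a)
  have ns := hNorm_nonneg M s (coeff a)
  -- For s ≥ 1 the order-s norm controls order 1, so R alone bounds the H¹ norm of the initial
  -- iterate.
  have n1 := hNorm_mono_order M le_rfl hs (coeff a)
  have hY : yNorm M (coeff a) ≤ R ^ 2 := by unfold yNorm; nlinarith
  have hS : hNorm M s (coeff a) ≤ R ^ 2 := by nlinarith
  have hyB : ∀ n, yNorm M (coeffIter ν M τ a n) ≤ B := fun n =>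
    (hy n).trans (max_le_max hY le_rfl)
  have key := h M τ (coeffIter ν M τ a) hp (herm_coeffIter ν M τ a) hadm (fun _ => rfl) hyB
    (hS.trans (le_max_left _ _)) n
  refine Real.le_sqrt_of_sq_le ?_
  rw [sobolevNorm_truncSum (herm_coeffIter ν M τ a n)]
  refine mul_le_mul_of_nonneg_left (add_le_add ?_ key) (by positivity)
  exact (le_add_of_nonneg_right (hNorm_nonneg _ _ _)).trans (hyB n)

end

end AllenCahn

end

theorem theorem1 :
    ∃ (τstar : ℝ → ℝ → ℝ → ℝ) (A₁ : ℝ → ℝ → ℝ → ℕ → ℝ),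
      (∀ l₀ γ ν : ℝ, 0 < l₀ → 0 ≤ γ → 0 < ν → 0 < τstar l₀ γ ν) ∧
      (∀ (R ν l₀ : ℝ) (k₀ : ℕ), 0 ≤ R → 0 < ν → 0 < l₀ → 1 ≤ k₀ → 0 < A₁ R ν l₀ k₀) ∧
      ∀ (ν l₀ : ℝ) (M : ℕ) (a : AllenCahn.Torus → ℝ) (τ : ℝ),
        0 < ν → 0 < l₀ → 2 ≤ M → AllenCahn.MemSobolev 1 a →
        0 < τ → τ ≤ l₀ * ((M : ℝ) ^ 2)⁻¹ → τ ≤ τstar l₀ (AllenCahn.sobolevNorm 1 a) ν →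
        (∃! u : ℕ → AllenCahn.Torus → ℝ, AllenCahn.IsIterates ν M τ a u) ∧
        ∀ u : ℕ → AllenCahn.Torus → ℝ, AllenCahn.IsIterates ν M τ a u →
          ∀ k₀ : ℕ, 1 ≤ k₀ → ∀ n : ℕ,
            AllenCahn.MemSobolev k₀ (u n) ∧
            AllenCahn.sobolevNorm k₀ (u n) ≤
              A₁ (AllenCahn.sobolevNorm k₀ (u 0)) ν l₀ k₀ := by
  choose τstar hτstar using AllenCahn.exists_timestep
  choose A₁ hA₁ using AllenCahn.exists_sobolevNorm_bound
  refine ⟨τstar, A₁, fun l γ ν hl hγ hν => (hτstar l γ ν hl hγ hν).1,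
    fun R ν l k hR hν hl hk => (hA₁ R ν l k hR hν hl hk).1, ?_⟩
  intro ν l M a τ hν hl hM ha hτ hτM hτT
  have hM0 : (0 : ℝ) < (M : ℝ) ^ 2 := by positivity
  obtain ⟨hp, hn⟩ := (hτstar l _ ν hl (Real.sqrt_nonneg _) hν).2 M a τ ha rfl hτ
    ((le_mul_inv_iff₀ hM0).1 hτM) hτT
  have hiff := AllenCahn.isIterates_iff fun n => (hn n).1
  refine ⟨⟨_, (hiff _).2 rfl, fun u hu => (hiff u).1 hu⟩, ?_⟩
  intro u hu k hk n
  rw [hiff] at hu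
  subst hu
  refine ⟨AllenCahn.memSobolev_truncSum (AllenCahn.herm_coeffIter ν M τ a n) M k, ?_⟩
  exact (hA₁ _ ν l k (Real.sqrt_nonneg _) hν hl hk).2 M τ a hp (fun n => (hn n).1)
    (fun n => (hn n).2) rfl n
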